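/- **Setting.** Let $\mathcal G_1,\dots,\mathcal G_D$ be finite connected undirected graphs without loops, with positive edge weights, disjoint node sets $\mathcal V_1,\dots,\mathcal V_D$ of the same size $N/D$, weighted Laplacians $\mathbf L_k$, and $\sum_v w(r,v)<1$ for every node $r$, the sum running over the neighbours $v$ of $r$ inside its subgraph. Let a backbone graph on $\{1,\dots,D\}$ with positive edge weights $w_{kl}$ and $D\times D$ weighted Laplacian $\widehat{\mathbf L}_{con}$ be given, choose one bridge node $s_k\in\mathcal V_k$ in each subgraph, and connect $s_k$ and $s_l$ by an edge of weight $w_{kl}$ for each backbone edge. Let $\beta\in\mathbb R$ and put $$\mathbf L_{sub}=\operatorname{diag}(\mathbf L_1,\dots,\mathbf L_D),\qquad \mathbf B=\beta\sum_{k<l}w_{kl}(e_{s_k}-e_{s_l})(e_{s_k}-e_{s_l})^T,\qquad \mathbf P=\mathbf I-\tfrac1N\mathbf 1\mathbf 1^T,\qquad \tilde{\mathbf A}=\mathbf P(\mathbf I-\mathbf L_{sub})\mathbf P .$$ When all connecting edges are activated together with probability $p$, the mean square operator is $$\mathcal A(X)=\mathbf P(\mathbf I-\mathbf L_{sub}-p\mathbf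 B)\mathbf P\,X\,\mathbf P(\mathbf I-\mathbf L_{sub}-p\mathbf B)\mathbf P+p(1-p)\,\mathbf B X\mathbf B .$$ Let $\lambda_1(\widehat{\mathbf L}_{con})\le\dots\le\lambda_D(\widehat{\mathbf L}_{con})$ be the eigenvalues of $\widehat{\mathbf L}_{con}$ with orthonormal eigenvectors $\mathbf u_1=\mathbf 1/\sqrt D,\mathbf u_2,\dots,\mathbf u_D$. Put $\widehat{\mathbf w}_i=\mathbf u_i/\sqrt{N/D}\in\mathbb R^D$, let $\mathbf w_i\in\mathbb R^N$ be the vector with constant value $\widehat{\mathbf w}_i(k)$ on $\mathcal V_k$, and $\mathbf W_{ij}=\mathbf w_i\mathbf w_j^T$. Use the inner product $\langle X,Y\rangle=\operatorname{tr}(X^TY)$. Let $\widehat{\mathcal I}$ be the $D\times D$ diagonal matrix with $\widehat{\mathcal I}(k,k)=\mathbf L_k^\dagger(s_k,s_k)$, where $\dagger$ is the Moore–Penrose inverse. **Claim.** (a) $\mathcal A=\mathcal A_0+p\mathcal A_1$ with $\mathcal A_0(X)=\tilde{\mathbf A}X\tilde{\mathbf A}$ and $\mathcal A_1(X)=-\mathbf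 BX\tilde{\mathbf A}-\tilde{\mathbf A}X\mathbf B+\mathbf BX\mathbf B$. For $i,j\in\{2,\dots,D\}$ the matrices $\mathbf W_{ij}$ are orthonormal eigenmatrices of $\mathcal A_0$ with eigenvalue $1$, and $\langle\mathbf W_{ij},\mathcal A_1(\mathbf W_{ab})\rangle=0$ for $(i,j)\ne(a,b)$. (b) For $i,j\in\{2,\dots,D\}$ and any complete orthonormal system of eigenmatrices $(\mathbf E_m,\mu_m)$ of $\mathcal A_0$, let $$C^{(2)}_{ij}=\sum_{m:\ \mu_m\neq1}\frac{\langle\mathbf W_{ij},\mathcal A_1(\mathbf E_m)\rangle^2}{1-\mu_m}$$ be the second-order perturbation coefficient of the eigenvalue $\lambda_{ij}(\mathcal A)$ that belongs to $\mathbf W_{ij}$. Whenever $\mathcal A(Y(p))=\gamma(p)Y(p)$ for all $p$ near $0$, with $\gamma$, $Y$ twice continuously differentiable near $0$ and $Y(0)=\mathbf W_{ij}$, then $\gamma''(0)/2=C^{(2)}_{ij}$. Moreover $$C^{(2)}_{ij}\ \ge\ \underline C_{ij}:=\beta^2\lambda_i(\widehat{\mathbf L}_{con})^2\Bigl(1-\beta\tfrac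 DN\lambda_j(\widehat{\mathbf L}_{con})\Bigr)^2\widehat{\mathbf w}_i^T\widehat{\mathcal I}\,\widehat{\mathbf w}_i+\beta^2\lambda_j(\widehat{\mathbf L}_{con})^2\Bigl(1-\beta\tfrac DN\lambda_i(\widehat{\mathbf L}_{con})\Bigr)^2\widehat{\mathbf w}_j^T\widehat{\mathcal I}\,\widehat{\mathbf w}_j ,$$ and, if all eigenvalues of all the $\mathbf L_k$ are at most $1$, $$C^{(2)}_{ij}\ \le\ \overline C_{ij}:=\underline C_{ij}+\beta^4\lambda_i(\widehat{\mathbf L}_{con})^2\lambda_j(\widehat{\mathbf L}_{con})^2\,\frac{D(N-D)}{N^2}\;\widehat{\mathbf w}_i^T\widehat{\mathcal I}\,\widehat{\mathbf w}_i .$$ (c) The information centrality of a node $r$ of $\mathcal G_k$ is $|\mathcal V_k|\big/\sum_{t\in\mathcal V_k}(c_{rr}+c_{tt}-2c_{rt})$, where $(c_{rt})=(\mathbf L_k+\mathbf 1\mathbf 1^T)^{-1}$. Each $\mathbf L_k^\dagger(s_k,s_k)$ is minimized over $s_k\in\mathcal V_k$ when $s_k$ has maximum information centrality in $\mathcal G_k$;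 and, with the subgraphs, the backbone graph, $\beta$ and the $\mathbf u_i$ fixed, both $\underline C_{ij}$ and $\overline C_{ij}$ are minimized over all choices of the bridge nodes when all bridge nodes have maximum information centrality in their subgraphs. -/

import Mathlib

open Matrix Filter Topology

namespace NoN

noncomputable section

/-- A finite weighted undirected graph without loops: the edges are the pairs of positive weight. -/
structure WeightedGraph (V : Type*) where
  weight : V → V → ℝ
  symm : ∀ r s, weight r s = weight s r
  nonneg : ∀ r s, 0 ≤ weight r s
  loopless : ∀ r, weight r r = 0

/-- The underlying simple graph. -/
def WeightedGraph.toSimpleGraph {V : Type*} (G : WeightedGraph V) : SimpleGraph V where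
  Adj r s := 0 < G.weight r s
  symm := ⟨fun r s h => by rw [G.symm s r]; exact h⟩
  loopless := ⟨fun r h => by rw [G.loopless r] at h; exact lt_irrefl _ h⟩

/-- The weighted Laplacian matrix. -/
def WeightedGraph.laplacian {V : Type*} [Fintype V] [DecidableEq V] (G : WeightedGraph V) :
    Matrix V V ℝ :=
  Matrix.of fun r s => if r = s then ∑ t, G.weight r t else -G.weight r s

theorem WeightedGraph.laplacian_isHermitian {V : Type*} [Fintype V] [DecidableEq V]
    (G : WeightedGraph V) : G.laplacian.IsHermitian := by
  ext r s
  by_cases h : r = s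
  · subst h; simp
  · simp [WeightedGraph.laplacian, Matrix.conjTranspose_apply, h, Ne.symm h, G.symm r s]

/-- The four Penrose equations: `X` is the Moore-Penrose inverse of the real matrix `A`. -/
def IsMoorePenrose {V : Type*} [Fintype V] (A X : Matrix V V ℝ) : Prop :=
  A * X * A = A ∧ X * A * X = X ∧ (A * X)ᵀ = A * X ∧ (X * A)ᵀ = X * A

/-- The Moore-Penrose inverse of a square real matrix. -/
def pinv {V : Type*} [Fintype V] (A : Matrix V V ℝ) : Matrix V V ℝ :=
  Classical.epsilon (IsMoorePenrose A)

theorem IsMoorePenrose.unique {V : Type*} [Fintype V] {A X Y : Matrix V V ℝ}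
    (hX : IsMoorePenrose A X) (hY : IsMoorePenrose A Y) : X = Y := by
  obtain ⟨x1, x2, x3, x4⟩ := hX
  obtain ⟨y1, y2, y3, y4⟩ := hY
  have e1 : A * X = A * Y := by
    calc A * X = (A * X)ᵀ := x3.symm
      _ = (A * Y * (A * X))ᵀ := by rw [← Matrix.mul_assoc (A * Y) A X, y1]
      _ = (A * X)ᵀ * (A * Y)ᵀ := Matrix.transpose_mul _ _
      _ = A * X * (A * Y) := by rw [x3, y3]
      _ = A * Y := by rw [← Matrix.mul_assoc, x1]
  have e2 : X * A = Y * A := by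
    calc X * A = (X * A)ᵀ := x4.symm
      _ = (X * A * (Y * A))ᵀ := by rw [Matrix.mul_assoc X A, ← Matrix.mul_assoc A Y A, y1]
      _ = (Y * A)ᵀ * (X * A)ᵀ := Matrix.transpose_mul _ _
      _ = Y * A * (X * A) := by rw [x4, y4]
      _ = Y * A := by rw [Matrix.mul_assoc Y A, ← Matrix.mul_assoc A X A, x1]
  calc X = X * A * X := x2.symm
    _ = Y * A * X := by rw [e2]
    _ = Y * (A * Y) := by rw [Matrix.mul_assoc, e1]
    _ = Y := by rw [← Matrix.mul_assoc, y2]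

/-- Symmetric matrices have a Moore-Penrose inverse, so `pinv` is that inverse. -/
theorem isMoorePenrose_pinv {V : Type*} [Fintype V] [DecidableEq V] {A : Matrix V V ℝ}
    (hA : A.IsHermitian) : IsMoorePenrose A (pinv A) := by
  refine Classical.epsilon_spec (p := IsMoorePenrose A) ?_
  obtain ⟨U, d, hUU, hspec⟩ : ∃ (U : Matrix V V ℝ) (d : V → ℝ),
      Uᵀ * U = 1 ∧ A = U * diagonal d * Uᵀ := by
    refine ⟨hA.eigenvectorUnitary, hA.eigenvalues, ?_, ?_⟩
    · have := Unitary.coe_star_mul_self hA.eigenvectorUnitary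
      rwa [star_eq_conjTranspose, conjTranspose_eq_transpose_of_trivial] at this
    · have h := hA.spectral_theorem
      rw [Unitary.conjStarAlgAut_apply, star_eq_conjTranspose,
        conjTranspose_eq_transpose_of_trivial] at h
      exact h
  have key : ∀ d e : V → ℝ, (U * diagonal d * Uᵀ) * (U * diagonal e * Uᵀ)
      = U * diagonal (fun v => d v * e v) * Uᵀ := by
    intro d e
    calc (U * diagonal d * Uᵀ) * (U * diagonal e * Uᵀ)
        = U * diagonal d * (Uᵀ * U) * diagonal e * Uᵀ := by simp only [Matrix.mul_assoc]
      _ = _ := by rw [hUU, Matrix.mul_one, Matrix.mul_assoc U, diagonal_mul_diagonal]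
  have keyT : ∀ d : V → ℝ, (U * diagonal d * Uᵀ)ᵀ = U * diagonal d * Uᵀ := by
    intro d
    simp [Matrix.transpose_mul, Matrix.mul_assoc]
  refine ⟨U * diagonal (fun v => (d v)⁻¹) * Uᵀ, ?_⟩
  subst hspec
  refine ⟨?_, ?_, ?_, ?_⟩
  · rw [key, key]
    congr 3
    funext v
    by_cases hv : d v = 0
    · simp [hv]
    · field_simp
  · rw [key, key]
    congr 3
    funext v
    by_cases hv : d v = 0
    · simp [hv]
    · field_simp
  · rw [key, keyT]
  · rw [key, keyT]

/-! Information centrality of Stephenson and Zelen. -/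

/-- The matrix `C = (L + J)⁻¹`, where `J` is the all-ones matrix. -/
def WeightedGraph.infoMatrix {V : Type*} [Fintype V] [DecidableEq V] (G : WeightedGraph V) :
    Matrix V V ℝ :=
  (G.laplacian + Matrix.of fun _ _ => 1)⁻¹

/-- The information `I_{rs} = (c_rr + c_ss - 2 c_rs)⁻¹` of the paths between `r` and `s`
(`I_{rr}` is infinite; it enters below only through its inverse `0`). -/
def WeightedGraph.pairInfo {V : Type*} [Fintype V] [DecidableEq V] (G : WeightedGraph V)
    (r s : V) : ℝ :=
  (G.infoMatrix r r + G.infoMatrix s s - 2 * G.infoMatrix r s)⁻¹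

/-- The information centrality of a node: the harmonic mean of the `I_{rs}` over all `s`. -/
def WeightedGraph.infoCentrality {V : Type*} [Fintype V] [DecidableEq V] (G : WeightedGraph V)
    (r : V) : ℝ :=
  (Fintype.card V : ℝ) / ∑ s, (G.pairInfo r s)⁻¹

/-- `r` has maximum information centrality in `G`. -/
def WeightedGraph.IsMostCentral {V : Type*} [Fintype V] [DecidableEq V] (G : WeightedGraph V)
    (r : V) : Prop :=
  ∀ t, G.infoCentrality t ≤ G.infoCentrality r

/-! A network of networks: subgraphs `G k` on `V k`, for `k : Fin D`, with one bridge node `s k` in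
each of them; the backbone graph `H` on `Fin D` gives the connecting edge between `s k` and `s l`
the weight `H.weight k l`. The node set is the disjoint union `Σ k, V k`. -/

/-- The block diagonal matrix with blocks `L_k`. -/
def lapSub {D : ℕ} {V : Fin D → Type*} [∀ k, Fintype (V k)] [∀ k, DecidableEq (V k)]
    (G : ∀ k, WeightedGraph (V k)) : Matrix (Σ k, V k) (Σ k, V k) ℝ :=
  Matrix.blockDiagonal' fun k => (G k).laplacian

/-- The vector with entry `1` at `r`, entry `-1` at `s`, and `0` elsewhere (for `r ≠ s`). -/
def edgeVec {V : Type*} [DecidableEq V] (r s : V) : V → ℝ :=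
  Pi.single r 1 - Pi.single s 1

/-- `B`: the sum over the connecting edges `e(r,s)` of `β w(r,s) b_rs b_rsᵀ`. -/
def matB {D : ℕ} {V : Fin D → Type*} [∀ k, DecidableEq (V k)] (H : WeightedGraph (Fin D))
    (s : ∀ k, V k) (β : ℝ) : Matrix (Σ k, V k) (Σ k, V k) ℝ :=
  ∑ k : Fin D, ∑ l : Fin D, if k < l then
    (β * H.weight k l) • vecMulVec (edgeVec (V := Σ k, V k) ⟨k, s k⟩ ⟨l, s l⟩)
      (edgeVec (V := Σ k, V k) ⟨k, s k⟩ ⟨l, s l⟩)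
  else 0

/-- The projection `P = I - (1/N) 1 1ᵀ`. -/
def proj (W : Type*) [Fintype W] [DecidableEq W] : Matrix W W ℝ :=
  1 - (1 / (Fintype.card W : ℝ)) • Matrix.of fun _ _ => 1

/-- The expected weight matrix `A - p B`, where `A = I - L_sub`. -/
def matAbar {D : ℕ} {V : Fin D → Type*} [∀ k, Fintype (V k)] [∀ k, DecidableEq (V k)]
    (G : ∀ k, WeightedGraph (V k)) (H : WeightedGraph (Fin D)) (s : ∀ k, V k) (β p : ℝ) :
    Matrix (Σ k, V k) (Σ k, V k) ℝ :=
  (1 - lapSub G) - p • matB H s β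

/-- The operator `X ↦ (P Ā P) X (P Ā P) + σ² B X B` that propagates the autocorrelation matrix of
the deviation from average; `σ² = p (1 - p)` is the variance of the Bernoulli activation. -/
def msOp {D : ℕ} {V : Fin D → Type*} [∀ k, Fintype (V k)] [∀ k, DecidableEq (V k)]
    (G : ∀ k, WeightedGraph (V k)) (H : WeightedGraph (Fin D)) (s : ∀ k, V k) (β p : ℝ)
    (X : Matrix (Σ k, V k) (Σ k, V k) ℝ) : Matrix (Σ k, V k) (Σ k, V k) ℝ :=
  (proj (Σ k, V k) * matAbar G H s β p * proj (Σ k, V k)) * X *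
      (proj (Σ k, V k) * matAbar G H s β p * proj (Σ k, V k)) +
    (p * (1 - p)) • (matB H s β * X * matB H s β)

/-- `Ã = P A P`. -/
def matAtilde {D : ℕ} {V : Fin D → Type*} [∀ k, Fintype (V k)] [∀ k, DecidableEq (V k)]
    (G : ∀ k, WeightedGraph (V k)) : Matrix (Σ k, V k) (Σ k, V k) ℝ :=
  proj (Σ k, V k) * (1 - lapSub G) * proj (Σ k, V k)

/-- The unperturbed operator `𝒜₀`. -/
def msOp₀ {D : ℕ} {V : Fin D → Type*} [∀ k, Fintype (V k)] [∀ k, DecidableEq (V k)]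
    (G : ∀ k, WeightedGraph (V k)) (X : Matrix (Σ k, V k) (Σ k, V k) ℝ) :
    Matrix (Σ k, V k) (Σ k, V k) ℝ :=
  matAtilde G * X * matAtilde G

/-- The first-order perturbation `𝒜₁`. -/
def msOp₁ {D : ℕ} {V : Fin D → Type*} [∀ k, Fintype (V k)] [∀ k, DecidableEq (V k)]
    (G : ∀ k, WeightedGraph (V k)) (H : WeightedGraph (Fin D)) (s : ∀ k, V k) (β : ℝ)
    (X : Matrix (Σ k, V k) (Σ k, V k) ℝ) : Matrix (Σ k, V k) (Σ k, V k) ℝ :=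
  -(matB H s β * X * matAtilde G) - matAtilde G * X * matB H s β + matB H s β * X * matB H s β

/-- The inner product `⟨X, Y⟩ = tr(Xᵀ Y)` of real matrices. -/
def frob {W : Type*} [Fintype W] (X Y : Matrix W W ℝ) : ℝ := (Xᵀ * Y).trace

/-- `(E a, μ a)`, for `a` in `W × W`, is a complete orthonormal system of eigenmatrices of the
operator `T` on `W × W` matrices (an orthonormal family of that many matrices is a basis). -/
def IsOrthonormalEigenbasis {W : Type*} [Fintype W] [DecidableEq W]
    (T : Matrix W W ℝ → Matrix W W ℝ) (E : W × W → Matrix W W ℝ) (μ : W × W → ℝ) : Prop :=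
  (∀ a b, frob (E a) (E b) = if a = b then 1 else 0) ∧ ∀ a, T (E a) = μ a • E a

/-- The second-order perturbation coefficient, for the perturbation `T₀ + p T₁`, that belongs to the
eigenmatrix `X` of `T₀` with eigenvalue `l`, computed in an eigenbasis `(E, μ)` of `T₀`. -/
def secondOrderCoeff {W : Type*} [Fintype W] (T₁ : Matrix W W ℝ → Matrix W W ℝ)
    (E : W × W → Matrix W W ℝ) (μ : W × W → ℝ) (X : Matrix W W ℝ) (l : ℝ) : ℝ :=
  open scoped Classical in
  ∑ a ∈ Finset.univ.filter (fun a => μ a ≠ l), frob X (T₁ (E a)) ^ 2 / (l - μ a)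

/-- The orthonormal eigenvectors `u i` of the Laplacian of the backbone graph with eigenvalues `lam i`
in increasing order (index `0` is the smallest one), the first of which is `(1/√D) 1`. -/
structure IsBackboneEigenbasis {D : ℕ} (H : WeightedGraph (Fin D)) (u : Fin D → Fin D → ℝ)
    (lam : Fin D → ℝ) : Prop where
  orthonormal : ∀ i j, u i ⬝ᵥ u j = if i = j then 1 else 0
  eigen : ∀ i, H.laplacian *ᵥ u i = lam i • u i
  mono : Monotone lam
  first : ∀ i : Fin D, (i : ℕ) = 0 → u i = fun _ => 1 / √(D : ℝ)

/-- `ŵ = u / √(N/D)`. -/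
def wHat {D : ℕ} (V : Fin D → Type*) [∀ k, Fintype (V k)] (u : Fin D → ℝ) : Fin D → ℝ :=
  fun k => u k / √((Fintype.card (Σ k, V k) : ℝ) / D)

/-- The block constant vector on all nodes with value `ŵ k` on the `k`-th subgraph. -/
def wVec {D : ℕ} (V : Fin D → Type*) [∀ k, Fintype (V k)] (u : Fin D → ℝ) : (Σ k, V k) → ℝ :=
  fun x => wHat V u x.1

/-- The diagonal matrix with entries `L_k†(s_k, s_k)`. -/
def matI {D : ℕ} {V : Fin D → Type*} [∀ k, Fintype (V k)] [∀ k, DecidableEq (V k)]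
    (G : ∀ k, WeightedGraph (V k)) (s : ∀ k, V k) : Matrix (Fin D) (Fin D) ℝ :=
  diagonal fun k => pinv (G k).laplacian (s k) (s k)

/-- The lower bound. -/
def lowerBound {D : ℕ} {V : Fin D → Type*} [∀ k, Fintype (V k)] [∀ k, DecidableEq (V k)]
    (G : ∀ k, WeightedGraph (V k)) (s : ∀ k, V k) (β : ℝ) (u : Fin D → Fin D → ℝ)
    (lam : Fin D → ℝ) (i j : Fin D) : ℝ :=
  β ^ 2 * lam i ^ 2 * (1 - β * (D / (Fintype.card (Σ k, V k) : ℝ)) * lam j) ^ 2 *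
      (wHat V (u i) ⬝ᵥ (matI G s *ᵥ wHat V (u i))) +
    β ^ 2 * lam j ^ 2 * (1 - β * (D / (Fintype.card (Σ k, V k) : ℝ)) * lam i) ^ 2 *
      (wHat V (u j) ⬝ᵥ (matI G s *ᵥ wHat V (u j)))

/-- The upper bound. -/
def upperBound {D : ℕ} {V : Fin D → Type*} [∀ k, Fintype (V k)] [∀ k, DecidableEq (V k)]
    (G : ∀ k, WeightedGraph (V k)) (s : ∀ k, V k) (β : ℝ) (u : Fin D → Fin D → ℝ)
    (lam : Fin D → ℝ) (i j : Fin D) : ℝ :=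
  lowerBound G s β u lam i j +
    β ^ 4 * lam i ^ 2 * lam j ^ 2 *
      ((D : ℝ) * ((Fintype.card (Σ k, V k) : ℝ) - D) / (Fintype.card (Σ k, V k) : ℝ) ^ 2) *
      (wHat V (u i) ⬝ᵥ (matI G s *ᵥ wHat V (u i)))

end

end NoN

/-! Write `κ = D/N`, `p = β λ_i`, `q = β λ_j` (here `p` is not the activation probability). The
vectors `w_i` are block constant with mean zero, so `Ã` fixes them. The vector `B w_i` is supported
on the bridge nodes and equals `p (κ w_i + z_i)`, where `z_i` has mean zero on every block. Hence
`𝒜₁(W_ij)` is a multiple of `W_ij` plus a combination of `z_i w_jᵀ`, `w_i z_jᵀ` and `z_i z_jᵀ`.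

If `𝒜₁(W_ij) = c W_ij + (1 - 𝒜₀) R`, expanding in eigenmatrices turns the perturbation sum into `⟨R,
(1 - 𝒜₀) R⟩` (`secondOrderCoeff_eq`), independently of the eigenbasis. Such an `R` is explicit: the
pseudoinverses `L_k†` give potentials `y_i` with `y_i - Ã y_i = z_i`, which settles the two mixed
terms, and `exists_stein` gives `Q` with `Q - Ã Q Ã = z_i z_jᵀ`.

The three parts do not interact. The mixed terms contribute `p² (1 - κ q)² (y_i · z_i)` and `q² (1 -
κ p)² (y_j · z_j)`, with `y_i · z_i = ŵ_iᵀ Î ŵ_i`; together they are exactly the lower bound. The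
rest is `p² q² ⟨Q, z_i z_jᵀ⟩`, nonnegative because `Ã` has spectrum in `(-1, 1]`. If the spectrum
lies in `[0, 1]`, it is at most `p² q² (y_i · z_i)(z_j · z_j)`, where `z_j · z_j = κ (1 - κ)`; this
is the gap to the upper bound.

The Taylor statement follows by differentiating the eigenvalue equation twice after pairing it with
eigenmatrices of `𝒜₀` (`iteratedDeriv_two_eigenvalue`). For the centrality statement, `(L + J)⁻¹ =
L† + J/n²` makes the centrality of `r` equal to `n / (n L†(r,r) + tr L†)`, and both bounds increase
with each `L_k†(s_k, s_k)`. -/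

namespace NoN

/-! ### The Frobenius inner product and Parseval's identity -/

section Frobenius

variable {W : Type*} [Fintype W]

theorem frob_eq_sum (X Y : Matrix W W ℝ) : frob X Y = ∑ x, ∑ y, X x y * Y x y := by
  simp only [frob, Matrix.trace, Matrix.diag_apply, Matrix.mul_apply, Matrix.transpose_apply]
  exact Finset.sum_comm

theorem frob_comm (X Y : Matrix W W ℝ) : frob X Y = frob Y X := by
  simp only [frob_eq_sum, mul_comm]

theorem frob_add_right (X Y Z : Matrix W W ℝ) : frob X (Y + Z) = frob X Y + frob X Z := by
  simp [frob, Matrix.mul_add]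

theorem frob_sub_right (X Y Z : Matrix W W ℝ) : frob X (Y - Z) = frob X Y - frob X Z := by
  simp [frob, Matrix.mul_sub]

theorem frob_neg_right (X Y : Matrix W W ℝ) : frob X (-Y) = -frob X Y := by
  simp [frob]

theorem frob_smul_right (c : ℝ) (X Y : Matrix W W ℝ) : frob X (c • Y) = c * frob X Y := by
  simp [frob]

theorem frob_add_left (X Y Z : Matrix W W ℝ) : frob (X + Y) Z = frob X Z + frob Y Z := by
  rw [frob_comm, frob_add_right, frob_comm Z, frob_comm Z]

theorem frob_sub_left (X Y Z : Matrix W W ℝ) : frob (X - Y) Z = frob X Z - frob Y Z := by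
  rw [frob_comm, frob_sub_right, frob_comm Z, frob_comm Z]

theorem frob_neg_left (X Y : Matrix W W ℝ) : frob (-X) Y = -frob X Y := by
  rw [frob_comm, frob_neg_right, frob_comm Y]

theorem frob_smul_left (c : ℝ) (X Y : Matrix W W ℝ) : frob (c • X) Y = c * frob X Y := by
  rw [frob_comm, frob_smul_right, frob_comm Y]

theorem frob_vecMulVec (a b c d : W → ℝ) :
    frob (vecMulVec a b) (vecMulVec c d) = (a ⬝ᵥ c) * (b ⬝ᵥ d) := by
  simp only [frob_eq_sum, vecMulVec_apply, dotProduct, Finset.sum_mul_sum]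
  exact Finset.sum_congr rfl fun x _ => Finset.sum_congr rfl fun y _ => by ring

theorem frob_mul_mul {M K : Matrix W W ℝ} (hM : Mᵀ = M) (hK : Kᵀ = K) (X Y : Matrix W W ℝ) :
    frob X (M * Y * K) = frob (M * X * K) Y := by
  simp only [frob, Matrix.transpose_mul, hM, hK]
  rw [← Matrix.mul_assoc, Matrix.trace_mul_comm, ← Matrix.mul_assoc, ← Matrix.mul_assoc,
    Matrix.mul_assoc K]

theorem mul_vecMulVec_mul {M K : Matrix W W ℝ} (hK : Kᵀ = K) (a b : W → ℝ) :
    M * vecMulVec a b * K = vecMulVec (M *ᵥ a) (K *ᵥ b) := by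
  rw [Matrix.mul_vecMulVec, Matrix.vecMulVec_mul, ← Matrix.mulVec_transpose, hK]

variable [DecidableEq W]

/-- Parseval's identity in a complete orthonormal system of matrices. -/
theorem sum_frob_mul_frob {E : W × W → Matrix W W ℝ}
    (hE : ∀ a b, frob (E a) (E b) = if a = b then 1 else 0) (X Y : Matrix W W ℝ) :
    ∑ a, frob (E a) X * frob (E a) Y = frob X Y := by
  set M : Matrix (W × W) (W × W) ℝ := Matrix.of fun a x => E a x.1 x.2 with hM
  have h1 : M * Mᵀ = 1 := by
    ext a b
    rw [Matrix.mul_apply, Matrix.one_apply, ← hE a b, frob_eq_sum, Fintype.sum_prod_type]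
    rfl
  -- The system has as many members as matrices have entries, so `M` is square and its right inverse
  -- is a left inverse.
  have h2 : Mᵀ * M = 1 := mul_eq_one_comm.mp h1
  have h3 : ∀ (Z : Matrix W W ℝ) a, frob (E a) Z = (M *ᵥ fun x => Z x.1 x.2) a := by
    intro Z a
    rw [frob_eq_sum, Matrix.mulVec, dotProduct, Fintype.sum_prod_type]
    rfl
  simp only [h3]
  change (M *ᵥ _) ⬝ᵥ (M *ᵥ _) = _
  rw [Matrix.dotProduct_mulVec, Matrix.vecMul_mulVec, h2, Matrix.vecMul_one, frob_eq_sum, dotProduct,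
    Fintype.sum_prod_type]

end Frobenius

/-! ### Second-order perturbation of a degenerate eigenvalue -/

section Perturbation

variable {W : Type*} [Fintype W] [DecidableEq W] {T₀ T₁ : Matrix W W ℝ → Matrix W W ℝ}
  {E : W × W → Matrix W W ℝ} {μ : W × W → ℝ} {X : Matrix W W ℝ}

theorem IsOrthonormalEigenbasis.frob_apply (hE : IsOrthonormalEigenbasis T₀ E μ)
    (h₀ : ∀ X Y, frob X (T₀ Y) = frob (T₀ X) Y) (a : W × W) (R : Matrix W W ℝ) :
    frob (E a) (T₀ R) = μ a * frob (E a) R := by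
  rw [h₀, hE.2, frob_smul_left]

theorem IsOrthonormalEigenbasis.frob_eq_zero (hE : IsOrthonormalEigenbasis T₀ E μ)
    (h₀ : ∀ X Y, frob X (T₀ Y) = frob (T₀ X) Y) (hX : T₀ X = X) {a : W × W} (ha : μ a ≠ 1) :
    frob (E a) X = 0 := by
  have h := hE.frob_apply h₀ a X
  rw [hX] at h
  have : (1 - μ a) * frob (E a) X = 0 := by linarith
  exact (mul_eq_zero.mp this).resolve_left (sub_ne_zero.mpr ha.symm)

/-- If `T₁ X = c X + (1 - T₀) R`, the second-order coefficient is `⟨R, (1 - T₀) R⟩`. -/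
theorem secondOrderCoeff_eq (hE : IsOrthonormalEigenbasis T₀ E μ)
    (h₀ : ∀ X Y, frob X (T₀ Y) = frob (T₀ X) Y) (h₁ : ∀ X Y, frob X (T₁ Y) = frob (T₁ X) Y)
    (hX : T₀ X = X) {c : ℝ} {R : Matrix W W ℝ} (hR : T₁ X = c • X + (R - T₀ R)) :
    secondOrderCoeff T₁ E μ X 1 = frob R (R - T₀ R) := by
  classical
  rw [← sum_frob_mul_frob hE.1, secondOrderCoeff, Finset.sum_filter]
  refine Finset.sum_congr rfl fun a _ => ?_
  rw [frob_sub_right, hE.frob_apply h₀]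
  -- Off the eigenvalue `1`, `E a` is orthogonal to `X`, so `⟨E a, T₁ X⟩ = (1 - μ a) ⟨E a, R⟩` and
  -- one factor cancels against the denominator. On it, the Parseval term carries the factor `1 - μ
  -- a = 0`.
  split_ifs with ha
  · have hne : 1 - μ a ≠ 0 := sub_ne_zero.mpr (Ne.symm ha)
    rw [h₁, frob_comm, hR, frob_add_right, frob_smul_right, hE.frob_eq_zero h₀ hX ha,
      frob_sub_right, hE.frob_apply h₀]
    field_simp
    ring
  · rw [not_not.mp ha]; ring

omit [DecidableEq W] in
theorem contDiffAt_frob {Y : ℝ → Matrix W W ℝ}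
    (hY : ∀ x y, ContDiffAt ℝ 2 (fun p => Y p x y) 0) (Z : Matrix W W ℝ) :
    ContDiffAt ℝ 2 (fun p => frob Z (Y p)) 0 := by
  simp only [frob_eq_sum]
  exact ContDiffAt.sum fun x _ => ContDiffAt.sum fun y _ => contDiffAt_const.mul (hY x y)

omit [DecidableEq W] in
theorem deriv_frob {Y : ℝ → Matrix W W ℝ}
    (hY : ∀ x y, ContDiffAt ℝ 2 (fun p => Y p x y) 0) (Z : Matrix W W ℝ) :
    deriv (fun p => frob Z (Y p)) 0 = frob Z (Matrix.of fun x y => deriv (fun p => Y p x y) 0) := by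
  simp only [frob_eq_sum]
  have hd : ∀ x y, DifferentiableAt ℝ (fun p => Y p x y) 0 := fun x y =>
    (hY x y).differentiableAt (by norm_num)
  refine HasDerivAt.deriv (HasDerivAt.fun_sum fun x _ => HasDerivAt.fun_sum fun y _ => ?_)
  exact (hd x y).hasDerivAt.const_mul _

theorem iteratedDeriv_two_mul {f g : ℝ → ℝ} {x : ℝ} (hf : ContDiffAt ℝ 2 f x)
    (hg : ContDiffAt ℝ 2 g x) :
    iteratedDeriv 2 (fun p => f p * g p) x =
      iteratedDeriv 2 f x * g x + 2 * (deriv f x * deriv g x) + f x * iteratedDeriv 2 g x := by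
  have := iteratedDeriv_fun_mul (n := 2) hf hg
  rw [this]
  simp [Finset.sum_range_succ]
  ring

/-- The second Taylor coefficient of an eigenvalue branch of `T₀ + p T₁` is the second-order
perturbation coefficient. -/
theorem iteratedDeriv_two_eigenvalue (hE : IsOrthonormalEigenbasis T₀ E μ)
    (h₀ : ∀ X Y, frob X (T₀ Y) = frob (T₀ X) Y) (h₁ : ∀ X Y, frob X (T₁ Y) = frob (T₁ X) Y)
    (hX : T₀ X = X) (hXX : frob X X = 1) {γ : ℝ → ℝ} {Y : ℝ → Matrix W W ℝ}
    (hγ : ContDiffAt ℝ 2 γ 0) (hY : ∀ x y, ContDiffAt ℝ 2 (fun p => Y p x y) 0) (hY0 : Y 0 = X)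
    (h : ∀ᶠ p in 𝓝 (0 : ℝ), T₀ (Y p) + p • T₁ (Y p) = γ p • Y p) :
    iteratedDeriv 2 γ 0 / 2 = secondOrderCoeff T₁ E μ X 1 := by
  classical
  -- Self-adjointness moves both operators onto the fixed matrix `Z`, so only scalar functions of
  -- `p` have to be differentiated.
  have hpair : ∀ Z l, T₀ Z = l • Z →
      (fun p => p * frob (T₁ Z) (Y p)) =ᶠ[𝓝 0] fun p => (γ p - l) * frob Z (Y p) := by
    intro Z l hZ
    filter_upwards [h] with p hp
    have := congrArg (frob Z) hp
    rw [frob_add_right, frob_smul_right, frob_smul_right, h₀, h₁, hZ, frob_smul_left] at this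
    linarith
  have hγ0 : γ 0 = 1 := by
    have := (hpair X 1 (by rw [hX, one_smul])).eq_of_nhds
    rw [hY0, hXX] at this
    linarith
  have hdf := fun Z => (contDiffAt_frob hY Z).differentiableAt (by norm_num)
  have hdγ : DifferentiableAt ℝ γ 0 := hγ.differentiableAt (by norm_num)
  set Y' : Matrix W W ℝ := Matrix.of fun x y => deriv (fun p => Y p x y) 0 with hY'
  have first : ∀ Z l, T₀ Z = l • Z →
      frob (T₁ Z) X = deriv γ 0 * frob Z X + (1 - l) * frob Z Y' := by
    intro Z l hZ
    have e := (hpair Z l hZ).deriv_eq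
    rw [deriv_fun_mul differentiableAt_fun_id (hdf _), deriv_fun_mul (hdγ.sub_const l) (hdf _),
      deriv_sub_const, deriv_frob hY, deriv_frob hY, hγ0, hY0] at e
    simpa using e
  have second : 2 * frob (T₁ X) Y' =
      iteratedDeriv 2 γ 0 + 2 * (deriv γ 0 * frob X Y') := by
    have e := (hpair X 1 (by rw [hX, one_smul])).iteratedDeriv_eq 2
    rw [iteratedDeriv_two_mul (f := fun p => p) contDiffAt_id (contDiffAt_frob hY _),
      iteratedDeriv_two_mul (hγ.sub contDiffAt_const) (contDiffAt_frob hY _),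
      deriv_sub_const, deriv_frob hY, deriv_frob hY, hγ0, hY0, hXX] at e
    have e1 : iteratedDeriv 2 (fun p => γ p - 1) 0 = iteratedDeriv 2 γ 0 := by
      simp only [iteratedDeriv_succ, iteratedDeriv_zero]
      congr 1
      funext x
      exact deriv_sub_const (f := γ) (x := x) 1
    have e2 : iteratedDeriv 2 (fun p : ℝ => p) 0 = 0 := by
      simp [iteratedDeriv_succ, iteratedDeriv_zero]
    rw [e1, e2] at e
    simp at e
    linarith
  -- By `first`, the component of `T₁ X - γ'(0) X` along `E a` is `(1 - μ a) ⟨E a, Y'⟩`. It vanishes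
  -- throughout the degenerate eigenspace, so the unknown part of `Y'` there does no harm.
  have hcoef : secondOrderCoeff T₁ E μ X 1 = frob (T₁ X - deriv γ 0 • X) Y' := by
    rw [← sum_frob_mul_frob hE.1, secondOrderCoeff, Finset.sum_filter]
    refine Finset.sum_congr rfl fun a _ => ?_
    have e := first (E a) (μ a) (hE.2 a)
    rw [frob_sub_right, frob_smul_right, h₁ X, frob_comm (T₁ X)]
    rw [← h₁] at e
    split_ifs with ha
    · have hne : 1 - μ a ≠ 0 := sub_ne_zero.mpr (Ne.symm ha)
      rw [e, hE.frob_eq_zero h₀ hX ha]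
      field_simp
      ring
    · rw [e, not_not.mp ha]; ring
  rw [hcoef, frob_sub_left, frob_smul_left]
  linarith

end Perturbation

/-! ### The Stein equation for a symmetric matrix -/

section Stein

variable {W : Type*} [Fintype W] [DecidableEq W]

theorem exists_orthogonal_diagonalization {A : Matrix W W ℝ} (hA : A.IsHermitian) :
    ∃ (U : Matrix W W ℝ) (d : W → ℝ), Uᵀ * U = 1 ∧ A = U * diagonal d * Uᵀ := by
  refine ⟨hA.eigenvectorUnitary, hA.eigenvalues, ?_, ?_⟩
  · have := Unitary.coe_star_mul_self hA.eigenvectorUnitary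
    rwa [star_eq_conjTranspose, conjTranspose_eq_transpose_of_trivial] at this
  · have h := hA.spectral_theorem
    rw [Unitary.conjStarAlgAut_apply, star_eq_conjTranspose,
      conjTranspose_eq_transpose_of_trivial] at h
    exact h

/-- Solution of the Stein equation `Q - A Q A = z₁ z₂ᵀ` for a symmetric matrix `A` with eigenvalues in
`(-1, 1]` and vectors `z₁, z₂` in the range of `1 - A`. -/
theorem exists_stein {A : Matrix W W ℝ} (hA : A.IsHermitian)
    (hspec : ∀ (x : W → ℝ) (d : ℝ), x ≠ 0 → A *ᵥ x = d • x → -1 < d ∧ d ≤ 1) (y₁ y₂ : W → ℝ) :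
    ∃ Q : Matrix W W ℝ, Q - A * Q * A = vecMulVec (y₁ - A *ᵥ y₁) (y₂ - A *ᵥ y₂) ∧
      0 ≤ frob Q (vecMulVec (y₁ - A *ᵥ y₁) (y₂ - A *ᵥ y₂)) ∧
      ((∀ (x : W → ℝ) (d : ℝ), x ≠ 0 → A *ᵥ x = d • x → 0 ≤ d) →
        frob Q (vecMulVec (y₁ - A *ᵥ y₁) (y₂ - A *ᵥ y₂)) ≤
          (y₁ ⬝ᵥ (y₁ - A *ᵥ y₁)) * ((y₂ - A *ᵥ y₂) ⬝ᵥ (y₂ - A *ᵥ y₂))) := by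
  obtain ⟨U, d, hU, rfl⟩ := exists_orthogonal_diagonalization hA
  have hU' : U * Uᵀ = 1 := mul_eq_one_comm.mp hU
  have heig : ∀ a, (U *ᵥ Pi.single a 1) ≠ 0 ∧
      (U * diagonal d * Uᵀ) *ᵥ (U *ᵥ Pi.single a 1) = d a • (U *ᵥ Pi.single a 1) := by
    intro a
    constructor
    · intro h0
      have := congrArg (fun v => (Uᵀ *ᵥ v) a) h0
      simp only [Matrix.mulVec_mulVec, hU, Matrix.one_mulVec] at this
      simp at this
    · rw [Matrix.mulVec_mulVec, Matrix.mul_assoc, hU, Matrix.mul_one, ← Matrix.mulVec_mulVec,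
        ← Matrix.mulVec_smul]
      congr 1
      ext b
      by_cases hb : b = a
      · subst hb; simp
      · simp [hb]
  have hd : ∀ a, -1 < d a ∧ d a ≤ 1 := fun a => hspec _ _ (heig a).1 (heig a).2
  set c₁ := Uᵀ *ᵥ y₁ with hc₁
  set c₂ := Uᵀ *ᵥ y₂ with hc₂
  have hrange : ∀ y : W → ℝ, y - (U * diagonal d * Uᵀ) *ᵥ y =
      U *ᵥ (fun a => (1 - d a) * (Uᵀ *ᵥ y) a) := by
    intro y
    have : (fun a => (1 - d a) * (Uᵀ *ᵥ y) a) = Uᵀ *ᵥ y - diagonal d *ᵥ (Uᵀ *ᵥ y) := by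
      ext a; rw [Pi.sub_apply, Matrix.mulVec_diagonal]; ring
    rw [this, Matrix.mulVec_sub, Matrix.mulVec_mulVec, hU', Matrix.one_mulVec]
    simp [Matrix.mulVec_mulVec, Matrix.mul_assoc]
  rw [hrange, hrange, ← hc₁, ← hc₂]
  set f₁ : W → ℝ := fun a => (1 - d a) * c₁ a with hf₁
  set f₂ : W → ℝ := fun a => (1 - d a) * c₂ a with hf₂
  have hconj : ∀ a b : W → ℝ, vecMulVec (U *ᵥ a) (U *ᵥ b) = U * vecMulVec a b * Uᵀ := by
    intro a b
    rw [Matrix.mul_vecMulVec, Matrix.vecMulVec_mul, ← Matrix.mulVec_transpose,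
      Matrix.transpose_transpose]
  have hfrob : ∀ X Y : Matrix W W ℝ, frob (U * X * Uᵀ) (U * Y * Uᵀ) = frob X Y := by
    intro X Y
    simp only [frob, Matrix.transpose_mul, Matrix.transpose_transpose]
    rw [show U * (Xᵀ * Uᵀ) * (U * Y * Uᵀ) = U * Xᵀ * (Uᵀ * U) * Y * Uᵀ by
      simp only [Matrix.mul_assoc], hU, Matrix.mul_one, Matrix.trace_mul_comm]
    rw [← Matrix.mul_assoc, ← Matrix.mul_assoc, hU, Matrix.one_mul]
  have hdot : ∀ a b : W → ℝ, (U *ᵥ a) ⬝ᵥ (U *ᵥ b) = a ⬝ᵥ b := by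
    intro a b
    rw [Matrix.dotProduct_mulVec, Matrix.vecMul_mulVec, hU, Matrix.vecMul_one]
  have hy₁ : y₁ = U *ᵥ c₁ := by rw [hc₁, Matrix.mulVec_mulVec, hU', Matrix.one_mulVec]
  -- In eigencoordinates the equation decouples into `(1 - d a * d b) K a b = f₁ a * f₂ b`.
  set K : Matrix W W ℝ := Matrix.of fun a b => f₁ a * f₂ b / (1 - d a * d b) with hK
  -- A product of two numbers in `(-1, 1]` reaches `1` only if both are `1`. There `f₁` and `f₂`
  -- vanish, so the value of the division by zero is the right one.
  have hdd : ∀ a b, d a = 1 ∧ d b = 1 ∨ 0 < 1 - d a * d b := by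
    intro a b
    obtain ⟨h1, h2⟩ := hd a
    obtain ⟨h3, h4⟩ := hd b
    by_cases ha : d a = 1
    · by_cases hb : d b = 1
      · exact Or.inl ⟨ha, hb⟩
      · right; rw [ha]; have := lt_of_le_of_ne h4 hb; linarith
    · right; have := lt_of_le_of_ne h2 ha; nlinarith
  refine ⟨U * K * Uᵀ, ?_, ?_, ?_⟩
  · rw [hconj, show U * diagonal d * Uᵀ * (U * K * Uᵀ) * (U * diagonal d * Uᵀ) =
      U * diagonal d * (Uᵀ * U) * K * (Uᵀ * U) * diagonal d * Uᵀ by simp only [Matrix.mul_assoc],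
      hU, Matrix.mul_one, Matrix.mul_one,
      show U * diagonal d * K * diagonal d * Uᵀ = U * (diagonal d * K * diagonal d) * Uᵀ by
        simp only [Matrix.mul_assoc], ← Matrix.sub_mul, ← Matrix.mul_sub]
    congr 2
    ext a b
    rw [Matrix.sub_apply, Matrix.mul_diagonal, Matrix.diagonal_mul, vecMulVec_apply]
    simp only [hK, Matrix.of_apply]
    rcases hdd a b with ⟨h1, h2⟩ | h
    · simp [hf₁, h1]
    · have := h.ne'
      field_simp
  · rw [hconj, hfrob, frob_eq_sum]
    refine Finset.sum_nonneg fun a _ => Finset.sum_nonneg fun b _ => ?_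
    simp only [hK, Matrix.of_apply, vecMulVec_apply]
    rcases hdd a b with ⟨h1, h2⟩ | h
    · simp [hf₁, h1]
    · rw [div_mul_eq_mul_div]; exact div_nonneg (mul_self_nonneg _) h.le
  · intro hnn
    have hd0 : ∀ a, 0 ≤ d a := fun a => hnn _ _ (heig a).1 (heig a).2
    rw [hconj, hfrob, frob_eq_sum, hdot, hy₁, hdot, dotProduct, dotProduct, Finset.sum_mul_sum]
    refine Finset.sum_le_sum fun a _ => Finset.sum_le_sum fun b _ => ?_
    simp only [hK, Matrix.of_apply, vecMulVec_apply]
    rcases hdd a b with ⟨h1, h2⟩ | h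
    · simp [hf₁, h1]
    · rw [div_mul_eq_mul_div, div_le_iff₀ h]
      -- Replacing the denominator by `1 - d a` makes the double sum factor into the two dot
      -- products.
      have h1 : 1 - d a ≤ 1 - d a * d b := by nlinarith [hd0 a, (hd b).2]
      have h2 : 0 ≤ c₁ a * f₁ a * (f₂ b * f₂ b) := by
        rw [hf₁]
        have : 0 ≤ 1 - d a := by linarith [(hd a).2]
        have h3 : c₁ a * ((1 - d a) * c₁ a) * (f₂ b * f₂ b) =
          (1 - d a) * (c₁ a * f₂ b) ^ 2 := by ring
        simp only [h3]
        positivity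
      calc f₁ a * f₂ b * (f₁ a * f₂ b) = c₁ a * f₁ a * (f₂ b * f₂ b) * (1 - d a) := by
            simp only [hf₁]; ring
        _ ≤ _ := mul_le_mul_of_nonneg_left h1 h2

end Stein

/-! ### Quadratic form and kernel of the weighted Laplacian -/

namespace WeightedGraph

variable {V : Type*} [Fintype V] [DecidableEq V] (G : WeightedGraph V)

theorem laplacian_transpose : G.laplacianᵀ = G.laplacian := by
  have := G.laplacian_isHermitian
  rwa [Matrix.IsHermitian, conjTranspose_eq_transpose_of_trivial] at this

theorem laplacian_mulVec_apply (x : V → ℝ) (r : V) :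
    (G.laplacian *ᵥ x) r = ∑ t, G.weight r t * (x r - x t) := by
  have h : ∀ t, G.laplacian r t * x t =
      (if r = t then (∑ t, G.weight r t) * x t else 0) - G.weight r t * x t := by
    intro t
    by_cases h : r = t
    · subst h; simp [laplacian, G.loopless]
    · simp [laplacian, h]
  simp only [Matrix.mulVec, dotProduct, h, Finset.sum_sub_distrib, mul_sub, Finset.sum_ite_eq,
    Finset.mem_univ, if_true, Finset.sum_mul]

theorem laplacian_mulVec_const (c : ℝ) : (G.laplacian *ᵥ fun _ => c) = 0 := by
  ext r; simp [laplacian_mulVec_apply]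

theorem dotProduct_laplacian_mulVec (x : V → ℝ) :
    x ⬝ᵥ (G.laplacian *ᵥ x) = (∑ r, ∑ t, G.weight r t * (x r - x t) ^ 2) / 2 := by
  have h1 : x ⬝ᵥ (G.laplacian *ᵥ x) = ∑ r, ∑ t, G.weight r t * (x r * (x r - x t)) := by
    simp only [dotProduct, laplacian_mulVec_apply, Finset.mul_sum]
    exact Finset.sum_congr rfl fun r _ => Finset.sum_congr rfl fun t _ => by ring
  have h2 : x ⬝ᵥ (G.laplacian *ᵥ x) = ∑ r, ∑ t, G.weight r t * (x t * (x t - x r)) := by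
    rw [h1, Finset.sum_comm]
    exact Finset.sum_congr rfl fun r _ => Finset.sum_congr rfl fun t _ => by rw [G.symm]
  have h3 : (∑ r, ∑ t, G.weight r t * (x r - x t) ^ 2) =
      (∑ r, ∑ t, G.weight r t * (x r * (x r - x t))) +
        ∑ r, ∑ t, G.weight r t * (x t * (x t - x r)) := by
    simp only [← Finset.sum_add_distrib]
    exact Finset.sum_congr rfl fun r _ => Finset.sum_congr rfl fun t _ => by ring
  rw [h3, ← h1, ← h2]; ring

theorem dotProduct_laplacian_mulVec_nonneg (x : V → ℝ) : 0 ≤ x ⬝ᵥ (G.laplacian *ᵥ x) := by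
  rw [dotProduct_laplacian_mulVec]
  have := Finset.sum_nonneg fun r (_ : r ∈ Finset.univ) => Finset.sum_nonneg
    fun t (_ : t ∈ Finset.univ) => mul_nonneg (G.nonneg r t) (sq_nonneg (x r - x t))
  linarith

/-- From `(a - b)² ≤ 2a² + 2b²` on each edge; with all strengths below `1` this keeps the spectrum
of the Laplacian below `2`. -/
theorem dotProduct_laplacian_mulVec_le (x : V → ℝ) :
    x ⬝ᵥ (G.laplacian *ᵥ x) ≤ 2 * ∑ r, (∑ t, G.weight r t) * x r ^ 2 := by
  have h1 : (∑ r, ∑ t, G.weight r t * (x r - x t) ^ 2) ≤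
      ∑ r, ∑ t, (2 * (G.weight r t * x r ^ 2) + 2 * (G.weight r t * x t ^ 2)) := by
    refine Finset.sum_le_sum fun r _ => Finset.sum_le_sum fun t _ => ?_
    have := mul_nonneg (G.nonneg r t) (sq_nonneg (x r + x t))
    nlinarith
  have h2 : (∑ r, ∑ t, G.weight r t * x t ^ 2) = ∑ r, ∑ t, G.weight r t * x r ^ 2 := by
    rw [Finset.sum_comm]
    exact Finset.sum_congr rfl fun r _ => Finset.sum_congr rfl fun t _ => by rw [G.symm]
  simp only [Finset.sum_add_distrib, ← Finset.mul_sum, h2] at h1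
  rw [dotProduct_laplacian_mulVec]
  simp only [Finset.sum_mul]
  linarith

theorem dotProduct_laplacian_mulVec_le_of_eigenvalues
    (h : ∀ x, Module.End.HasEigenvalue (Matrix.toLin' G.laplacian) x → x ≤ 1) (x : V → ℝ) :
    x ⬝ᵥ (G.laplacian *ᵥ x) ≤ x ⬝ᵥ x := by
  have hH : (1 - G.laplacian).IsHermitian := Matrix.isHermitian_one.sub G.laplacian_isHermitian
  have hps : (1 - G.laplacian).PosSemidef := by
    rw [hH.posSemidef_iff_eigenvalues_nonneg]
    intro a
    have he := hH.mulVec_eigenvectorBasis a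
    set v : V → ℝ := ⇑(hH.eigenvectorBasis a) with hv
    have hne : v ≠ 0 := by
      intro h0
      have := hH.eigenvectorBasis.orthonormal.ne_zero a
      exact this (by ext i; exact congrFun h0 i)
    have hL : G.laplacian *ᵥ v = (1 - hH.eigenvalues a) • v := by
      rw [Matrix.sub_mulVec, Matrix.one_mulVec] at he
      rw [sub_smul, one_smul, ← he]; abel
    have := h (1 - hH.eigenvalues a) (Module.End.hasEigenvalue_of_hasEigenvector
      (x := v) ⟨Module.End.mem_eigenspace_iff.mpr (by rw [Matrix.toLin'_apply, hL]), hne⟩)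
    simpa using this
  have := hps.dotProduct_mulVec_nonneg x
  simp only [star_trivial, Matrix.sub_mulVec, Matrix.one_mulVec, dotProduct_sub] at this
  linarith

variable {G}

/-- Zero energy forces equal values at the ends of each edge, hence along every walk. -/
theorem eq_of_laplacian_mulVec_eq_zero (hG : G.toSimpleGraph.Connected) {x : V → ℝ}
    (hx : G.laplacian *ᵥ x = 0) (a b : V) : x a = x b := by
  have h := G.dotProduct_laplacian_mulVec x
  rw [hx, dotProduct_zero] at h
  have hnn : ∀ r t, 0 ≤ G.weight r t * (x r - x t) ^ 2 := fun r t =>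
    mul_nonneg (G.nonneg r t) (sq_nonneg _)
  have h0 : ∑ r, ∑ t, G.weight r t * (x r - x t) ^ 2 = 0 := by linarith
  have hz : ∀ r t, G.weight r t * (x r - x t) ^ 2 = 0 := fun r t =>
    (Finset.sum_eq_zero_iff_of_nonneg fun t _ => hnn r t).mp
      ((Finset.sum_eq_zero_iff_of_nonneg fun r _ => Finset.sum_nonneg fun t _ => hnn r t).mp h0 r
        (Finset.mem_univ r)) t (Finset.mem_univ t)
  obtain ⟨p⟩ := hG.preconnected a b
  induction p with
  | nil => rfl
  | cons hadj _ ih =>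
    rw [← ih]
    have := (mul_eq_zero.mp (hz _ _)).resolve_left (ne_of_gt hadj)
    exact sub_eq_zero.mp (pow_eq_zero_iff two_ne_zero |>.mp this)

/-! ### The pseudoinverse of the Laplacian and information centrality -/

variable (G)

theorem pinv_transpose : (pinv G.laplacian)ᵀ = pinv G.laplacian := by
  have h := isMoorePenrose_pinv G.laplacian_isHermitian
  refine IsMoorePenrose.unique (A := G.laplacian) ?_ h
  obtain ⟨h1, h2, h3, h4⟩ := h
  have hL := G.laplacian_transpose
  refine ⟨?_, ?_, ?_, ?_⟩
  · have := congrArg Matrix.transpose h1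
    simpa [Matrix.transpose_mul, hL, Matrix.mul_assoc] using this
  · have := congrArg Matrix.transpose h2
    simpa [Matrix.transpose_mul, hL, Matrix.mul_assoc] using this
  · have := congrArg Matrix.transpose h4
    simpa [Matrix.transpose_mul, hL, Matrix.mul_assoc] using this
  · have := congrArg Matrix.transpose h3
    simpa [Matrix.transpose_mul, hL, Matrix.mul_assoc] using this

theorem pinv_comm (r t : V) : pinv G.laplacian r t = pinv G.laplacian t r := by
  conv_lhs => rw [← G.pinv_transpose, Matrix.transpose_apply]

/-- By symmetry `L†` commutes with `L`, so `L† = L† L† L`, and `L` kills constants. -/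
theorem pinv_mulVec_one : (pinv G.laplacian *ᵥ fun _ => (1 : ℝ)) = 0 := by
  obtain ⟨-, h2, h3, -⟩ := isMoorePenrose_pinv G.laplacian_isHermitian
  have h : pinv G.laplacian = pinv G.laplacian * (pinv G.laplacian * G.laplacian) := by
    rw [Matrix.transpose_mul, G.pinv_transpose, G.laplacian_transpose] at h3
    rw [h3, ← Matrix.mul_assoc, h2]
  rw [h, ← Matrix.mulVec_mulVec, ← Matrix.mulVec_mulVec, G.laplacian_mulVec_const,
    Matrix.mulVec_zero, Matrix.mulVec_zero]

theorem sum_pinv (r : V) : ∑ t, pinv G.laplacian r t = 0 := by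
  have := congrFun G.pinv_mulVec_one r
  simpa [Matrix.mulVec, dotProduct] using this

/-- Since `L† = L† L L†`, the entry is the Laplacian energy of a column of `L†`. -/
theorem pinv_diag_nonneg (r : V) : 0 ≤ pinv G.laplacian r r := by
  obtain ⟨-, h2, -, -⟩ := isMoorePenrose_pinv G.laplacian_isHermitian
  have h := G.dotProduct_laplacian_mulVec_nonneg (pinv G.laplacian *ᵥ Pi.single r 1)
  have e : (pinv G.laplacian *ᵥ Pi.single r 1) ⬝ᵥ
      (G.laplacian *ᵥ (pinv G.laplacian *ᵥ Pi.single r 1)) =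
      Pi.single r 1 ⬝ᵥ ((pinv G.laplacian * G.laplacian * pinv G.laplacian) *ᵥ Pi.single r 1) := by
    rw [← Matrix.mulVec_mulVec, ← Matrix.mulVec_mulVec, Matrix.dotProduct_mulVec (Pi.single r 1),
      ← Matrix.mulVec_transpose, G.pinv_transpose]
  rw [e, h2] at h
  simpa using h

variable {G}

/-- `1 - L L†` is symmetric with columns in the kernel of `L`, which connectedness makes the
constants. So all its entries agree, and `L† 1 = 0` makes each row sum `1`. -/
theorem laplacian_mul_pinv (hG : G.toSimpleGraph.Connected) :
    G.laplacian * pinv G.laplacian =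
      1 - (1 / (Fintype.card V : ℝ)) • Matrix.of fun _ _ => (1 : ℝ) := by
  obtain ⟨h1, h2, h3, h4⟩ := isMoorePenrose_pinv G.laplacian_isHermitian
  have := hG.nonempty
  set M := 1 - G.laplacian * pinv G.laplacian with hM
  have hMT : Mᵀ = M := by rw [hM, Matrix.transpose_sub, h3, Matrix.transpose_one]
  have hLM : G.laplacian * M = 0 := by
    have : M * G.laplacian = 0 := by rw [hM, Matrix.sub_mul, h1, Matrix.one_mul, sub_self]
    have := congrArg Matrix.transpose this
    rwa [Matrix.transpose_mul, hMT, G.laplacian_transpose, Matrix.transpose_zero] at this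
  have hcol : ∀ a b c, M a c = M b c := fun a b c =>
    eq_of_laplacian_mulVec_eq_zero hG (x := fun v => M v c)
      (by ext r; exact congrFun (congrFun hLM r) c) a b
  have hrow : ∀ a b c, M c a = M c b := fun a b c => by
    rw [← hMT]; exact hcol a b c
  have hone : ∀ r, ∑ t, M r t = 1 := by
    intro r
    have : M *ᵥ (fun _ => (1 : ℝ)) = fun _ => 1 := by
      rw [hM, Matrix.sub_mulVec, Matrix.one_mulVec, ← Matrix.mulVec_mulVec, G.pinv_mulVec_one,
        Matrix.mulVec_zero, sub_zero]
    simpa [Matrix.mulVec, dotProduct] using congrFun this r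
  have hval : ∀ r t, M r t = 1 / (Fintype.card V : ℝ) := by
    intro r t
    have h := hone r
    rw [Finset.sum_congr rfl fun a _ => hrow a t r] at h
    have hc : (Fintype.card V : ℝ) ≠ 0 := Nat.cast_ne_zero.mpr Fintype.card_ne_zero
    rw [eq_div_iff hc, mul_comm]
    simpa using h
  have : G.laplacian * pinv G.laplacian = 1 - M := by rw [hM]; abel
  rw [this]
  congr 1
  ext r t
  simp [hval]

theorem infoMatrix_apply (hG : G.toSimpleGraph.Connected) (r t : V) :
    G.infoMatrix r t = pinv G.laplacian r t + 1 / (Fintype.card V : ℝ) ^ 2 := by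
  have := hG.nonempty
  have hc : (Fintype.card V : ℝ) ≠ 0 := Nat.cast_ne_zero.mpr Fintype.card_ne_zero
  have h : G.infoMatrix = pinv G.laplacian +
      (1 / (Fintype.card V : ℝ) ^ 2) • Matrix.of fun _ _ => (1 : ℝ) := by
    rw [infoMatrix]
    apply Matrix.inv_eq_right_inv
    rw [Matrix.mul_add, Matrix.add_mul, Matrix.add_mul, laplacian_mul_pinv hG]
    have e1 : (Matrix.of fun _ _ => (1 : ℝ)) * pinv G.laplacian = 0 := by
      ext a b
      simp only [Matrix.mul_apply, Matrix.of_apply, one_mul, Matrix.zero_apply]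
      rw [← G.sum_pinv b]
      exact Finset.sum_congr rfl fun t _ => G.pinv_comm _ _
    have e2 : G.laplacian * ((1 / (Fintype.card V : ℝ) ^ 2) • Matrix.of fun _ _ => (1 : ℝ)) = 0 := by
      ext a b
      exact congrFun (G.laplacian_mulVec_const (1 / (Fintype.card V : ℝ) ^ 2 * 1)) a
    rw [e1, e2]
    ext a b
    simp [Matrix.mul_apply]
    field_simp
    ring
  rw [h]
  simp

/-- The shift `1/n²` in the information matrix cancels in every pair, and the cross terms vanish
because the rows of `L†` sum to zero. Only `L†(r,r)` depends on the node. -/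
theorem infoCentrality_eq (hG : G.toSimpleGraph.Connected) (r : V) :
    G.infoCentrality r = (Fintype.card V : ℝ) /
      ((Fintype.card V : ℝ) * pinv G.laplacian r r + ∑ t, pinv G.laplacian t t) := by
  rw [infoCentrality]
  congr 1
  have h : ∀ t, (G.pairInfo r t)⁻¹ =
      pinv G.laplacian r r + pinv G.laplacian t t - 2 * pinv G.laplacian r t := by
    intro t
    rw [pairInfo, inv_inv, infoMatrix_apply hG, infoMatrix_apply hG, infoMatrix_apply hG]
    ring
  simp only [h, Finset.sum_sub_distrib, Finset.sum_add_distrib, ← Finset.mul_sum, G.sum_pinv]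
  simp

/-- A node of maximum information centrality minimizes the diagonal of the pseudoinverse. -/
theorem IsMostCentral.pinv_le (hG : G.toSimpleGraph.Connected) {t : V} (ht : G.IsMostCentral t)
    (v : V) : pinv G.laplacian t t ≤ pinv G.laplacian v v := by
  have := hG.nonempty
  have hc : (0 : ℝ) < Fintype.card V := Nat.cast_pos.mpr Fintype.card_pos
  have h := ht v
  rw [infoCentrality_eq hG, infoCentrality_eq hG] at h
  have htr : pinv G.laplacian t t ≤ ∑ a, pinv G.laplacian a a :=
    Finset.single_le_sum (fun a _ => G.pinv_diag_nonneg a) (Finset.mem_univ t)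
  have hv := G.pinv_diag_nonneg v
  have ht0 := G.pinv_diag_nonneg t
  have hcv := mul_nonneg hc.le hv
  have hct := mul_nonneg hc.le ht0
  -- If the denominator at `v` is zero, its nonnegative parts vanish; in particular the trace does,
  -- which bounds the entry at `t`. Otherwise the centrality of `v` is positive, hence so is that of
  -- `t`, and the fractions can be compared.
  rcases eq_or_lt_of_le (add_nonneg hcv (ht0.trans htr)) with h0 | h0
  · linarith
  · have hpos : (0 : ℝ) < Fintype.card V * pinv G.laplacian t t + ∑ a, pinv G.laplacian a a := by
      have := (div_pos hc h0).trans_le h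
      exact (div_pos_iff_of_pos_left hc).mp this
    rw [div_le_div_iff_of_pos_left hc h0 hpos] at h
    have : (Fintype.card V : ℝ) * pinv G.laplacian t t ≤ Fintype.card V * pinv G.laplacian v v := by
      linarith
    exact le_of_mul_le_mul_left this hc

end WeightedGraph

/-! ### The projection onto mean-free vectors -/

section Projection

variable {W : Type*} [Fintype W] [DecidableEq W]

theorem proj_transpose : (proj W)ᵀ = proj W := by
  rw [proj, Matrix.transpose_sub, Matrix.transpose_one, Matrix.transpose_smul]
  rfl

theorem proj_mulVec_apply (x : W → ℝ) (a : W) :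
    (proj W *ᵥ x) a = x a - 1 / (Fintype.card W : ℝ) * ∑ b, x b := by
  rw [proj, Matrix.sub_mulVec, Matrix.one_mulVec, Matrix.smul_mulVec]
  simp [Matrix.mulVec, dotProduct]

theorem mul_proj {M : Matrix W W ℝ} (hM : (M *ᵥ fun _ => (1 : ℝ)) = 0) : M * proj W = M := by
  rw [proj, Matrix.mul_sub, Matrix.mul_one, Matrix.mul_smul, sub_eq_self]
  ext a b
  have := congrFun hM a
  simp only [Matrix.mulVec, dotProduct, Pi.zero_apply] at this
  simp [Matrix.mul_apply] at this ⊢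
  exact Or.inr this

theorem proj_mul {M : Matrix W W ℝ} (hT : Mᵀ = M) (hM : (M *ᵥ fun _ => (1 : ℝ)) = 0) :
    proj W * M = M := by
  have := congrArg Matrix.transpose (mul_proj hM)
  rwa [Matrix.transpose_mul, proj_transpose, hT] at this

theorem proj_mulVec_one : (proj W *ᵥ fun _ => (1 : ℝ)) = 0 := by
  ext a
  rw [proj_mulVec_apply]
  have : Nonempty W := ⟨a⟩
  have hc : (Fintype.card W : ℝ) ≠ 0 := Nat.cast_ne_zero.mpr Fintype.card_ne_zero
  simp [hc]

omit [DecidableEq W] in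
theorem sum_mulVec_eq_zero {M : Matrix W W ℝ} (hT : Mᵀ = M)
    (hM : (M *ᵥ fun _ => (1 : ℝ)) = 0) (x : W → ℝ) : ∑ a, (M *ᵥ x) a = 0 := by
  have h : (fun _ => (1 : ℝ)) ⬝ᵥ (M *ᵥ x) = 0 := by
    rw [Matrix.dotProduct_mulVec, ← Matrix.mulVec_transpose, hT, hM, zero_dotProduct]
  simpa [dotProduct] using h

end Projection

/-! ### The matrices and operators of the network -/

section Network

variable {D : ℕ} {V : Fin D → Type*} [∀ k, Fintype (V k)] [∀ k, DecidableEq (V k)]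
  (G : ∀ k, WeightedGraph (V k)) (H : WeightedGraph (Fin D)) (s : ∀ k, V k) (β : ℝ)

theorem lapSub_transpose : (lapSub G)ᵀ = lapSub G := by
  rw [lapSub, Matrix.blockDiagonal'_transpose]
  simp only [WeightedGraph.laplacian_transpose]

theorem lapSub_mulVec_apply (x : (Σ k, V k) → ℝ) (k : Fin D) (r : V k) :
    (lapSub G *ᵥ x) ⟨k, r⟩ = ((G k).laplacian *ᵥ fun v => x ⟨k, v⟩) r := by
  simp only [lapSub, Matrix.mulVec, dotProduct]
  rw [Fintype.sum_sigma, Finset.sum_eq_single k]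
  · simp [Matrix.blockDiagonal'_apply_eq]
  · intro l _ hl
    exact Finset.sum_eq_zero fun v _ => by
      rw [Matrix.blockDiagonal'_apply_ne _ _ _ hl.symm, zero_mul]
  · simp

theorem dotProduct_lapSub_mulVec (x : (Σ k, V k) → ℝ) :
    x ⬝ᵥ (lapSub G *ᵥ x) =
      ∑ k, (fun v => x ⟨k, v⟩) ⬝ᵥ ((G k).laplacian *ᵥ fun v => x ⟨k, v⟩) := by
  simp only [dotProduct, Fintype.sum_sigma, lapSub_mulVec_apply]

theorem lapSub_mulVec_block (g : Fin D → ℝ) : (lapSub G *ᵥ fun x => g x.1) = 0 := by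
  ext ⟨k, r⟩
  rw [lapSub_mulVec_apply]
  exact congrFun ((G k).laplacian_mulVec_const (g k)) r

theorem matAtilde_eq : matAtilde G = proj (Σ k, V k) - lapSub G := by
  have h := lapSub_mulVec_block G (fun _ => 1)
  rw [matAtilde, Matrix.mul_sub, Matrix.mul_one, Matrix.sub_mul, mul_proj proj_mulVec_one,
    proj_mul (lapSub_transpose G) h, mul_proj h]

theorem matAtilde_transpose : (matAtilde G)ᵀ = matAtilde G := by
  rw [matAtilde_eq, Matrix.transpose_sub, proj_transpose, lapSub_transpose]

theorem matAtilde_mulVec {x : (Σ k, V k) → ℝ} (hx : ∑ a, x a = 0) :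
    matAtilde G *ᵥ x = x - lapSub G *ᵥ x := by
  rw [matAtilde_eq, Matrix.sub_mulVec]
  congr 1
  ext a
  rw [proj_mulVec_apply, hx, mul_zero, sub_zero]

theorem matAtilde_mulVec_one : (matAtilde G *ᵥ fun _ => (1 : ℝ)) = 0 := by
  rw [matAtilde_eq, Matrix.sub_mulVec, proj_mulVec_one, lapSub_mulVec_block G fun _ => 1, sub_zero]

/-- An eigenvector for a nonzero eigenvalue lies in the range of `Ã`, hence is mean free, and there
`Ã` acts as `1 - L_sub`. -/
theorem matAtilde_rayleigh {x : (Σ k, V k) → ℝ} {d : ℝ} (hd : d ≠ 0)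
    (h : matAtilde G *ᵥ x = d • x) :
    (1 - d) * (x ⬝ᵥ x) = ∑ k, (fun v => x ⟨k, v⟩) ⬝ᵥ
      ((G k).laplacian *ᵥ fun v => x ⟨k, v⟩) := by
  have hs := sum_mulVec_eq_zero (matAtilde_transpose G) (matAtilde_mulVec_one G) x
  rw [h] at hs
  simp only [Pi.smul_apply, smul_eq_mul, ← Finset.mul_sum] at hs
  rw [matAtilde_mulVec G ((mul_eq_zero.mp hs).resolve_left hd)] at h
  rw [← dotProduct_lapSub_mulVec, show lapSub G *ᵥ x = x - d • x by rw [← h]; abel,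
    dotProduct_sub, dotProduct_smul, smul_eq_mul]
  ring

omit [∀ k, DecidableEq (V k)] in
theorem dotProduct_self_sigma (x : (Σ k, V k) → ℝ) :
    x ⬝ᵥ x = ∑ k, (fun v => x ⟨k, v⟩) ⬝ᵥ (fun v => x ⟨k, v⟩) := by
  simp only [dotProduct, Fintype.sum_sigma]

-- Nonnegative energy gives `d ≤ 1`. Strengths strictly below `1` bound the energy strictly by `2 (x
-- · x)`, which gives `-1 < d`.
variable {G} in
theorem matAtilde_eigenvalue_bounds (hstrength : ∀ k r, ∑ v, (G k).weight r v < 1)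
    (x : (Σ k, V k) → ℝ) (d : ℝ) (hx : x ≠ 0) (h : matAtilde G *ᵥ x = d • x) :
    -1 < d ∧ d ≤ 1 := by
  by_cases hd : d = 0
  · subst hd; norm_num
  have e := matAtilde_rayleigh G hd h
  have hpos : 0 < x ⬝ᵥ x := lt_of_le_of_ne (Finset.sum_nonneg fun a _ => mul_self_nonneg _)
    fun h0 => hx (dotProduct_self_eq_zero.mp h0.symm)
  have h0 : 0 ≤ (1 - d) * (x ⬝ᵥ x) := by
    rw [e]
    exact Finset.sum_nonneg fun k _ => (G k).dotProduct_laplacian_mulVec_nonneg _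
  refine ⟨?_, by by_contra hc; nlinarith⟩
  have h2 : (1 - d) * (x ⬝ᵥ x) ≤ 2 * ∑ a : Σ k, V k, (∑ t, (G a.1).weight a.2 t) * x a ^ 2 := by
    rw [e, Fintype.sum_sigma, Finset.mul_sum]
    exact Finset.sum_le_sum fun k _ => (G k).dotProduct_laplacian_mulVec_le _
  obtain ⟨a, ha⟩ : ∃ a, x a ≠ 0 := by
    by_contra hc
    push Not at hc
    exact hx (funext hc)
  have h3 : ∑ a : Σ k, V k, (∑ t, (G a.1).weight a.2 t) * x a ^ 2 < x ⬝ᵥ x := by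
    rw [dotProduct]
    refine Finset.sum_lt_sum (fun b _ => ?_) ⟨a, Finset.mem_univ a, ?_⟩
    · nlinarith [sq_nonneg (x b), hstrength b.1 b.2]
    · have : 0 < x a ^ 2 := by positivity
      nlinarith [hstrength a.1 a.2]
  by_contra hc
  nlinarith

variable {G} in
theorem matAtilde_eigenvalue_nonneg
    (hL : ∀ k x, Module.End.HasEigenvalue (Matrix.toLin' (G k).laplacian) x → x ≤ 1)
    (x : (Σ k, V k) → ℝ) (d : ℝ) (hx : x ≠ 0) (h : matAtilde G *ᵥ x = d • x) : 0 ≤ d := by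
  by_cases hd : d = 0
  · exact hd.ge
  have e := matAtilde_rayleigh G hd h
  have hpos : 0 < x ⬝ᵥ x := lt_of_le_of_ne (Finset.sum_nonneg fun a _ => mul_self_nonneg _)
    fun h0 => hx (dotProduct_self_eq_zero.mp h0.symm)
  have h1 : (1 - d) * (x ⬝ᵥ x) ≤ x ⬝ᵥ x := by
    rw [e, dotProduct_self_sigma]
    exact Finset.sum_le_sum fun k _ =>
      (G k).dotProduct_laplacian_mulVec_le_of_eigenvalues (hL k) _
  by_contra hc
  nlinarith

theorem msOp₀_selfAdjoint (X Y : Matrix (Σ k, V k) (Σ k, V k) ℝ) :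
    frob X (msOp₀ G Y) = frob (msOp₀ G X) Y :=
  frob_mul_mul (matAtilde_transpose G) (matAtilde_transpose G) X Y

/-- The vector with value `g k` at the bridge node of the `k`-th subgraph, and `0` elsewhere. -/
def bridgeVec (g : Fin D → ℝ) : (Σ k, V k) → ℝ := fun x => if x.2 = s x.1 then g x.1 else 0

theorem bridgeVec_dotProduct (g : Fin D → ℝ) (x : (Σ k, V k) → ℝ) :
    bridgeVec s g ⬝ᵥ x = g ⬝ᵥ fun k => x ⟨k, s k⟩ := by
  simp [dotProduct, bridgeVec, Fintype.sum_sigma]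

omit [∀ k, Fintype (V k)] in
theorem matB_transpose : (matB H s β)ᵀ = matB H s β := by
  rw [matB, Matrix.transpose_sum]
  refine Finset.sum_congr rfl fun k _ => ?_
  rw [Matrix.transpose_sum]
  refine Finset.sum_congr rfl fun l _ => ?_
  split_ifs
  · rw [Matrix.transpose_smul, Matrix.transpose_vecMulVec]
  · simp

theorem edgeVec_dotProduct {W : Type*} [Fintype W] [DecidableEq W] (r t : W) (x : W → ℝ) :
    edgeVec r t ⬝ᵥ x = x r - x t := by
  simp [edgeVec, sub_dotProduct]

omit [∀ k, Fintype (V k)] in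
theorem bridgeVec_eq_sum (g : Fin D → ℝ) :
    bridgeVec s g = ∑ k, g k • (Pi.single ⟨k, s k⟩ 1 : (Σ k, V k) → ℝ) := by
  ext ⟨k, v⟩
  rw [Finset.sum_apply, Finset.sum_eq_single k]
  · simp only [bridgeVec, Pi.smul_apply, smul_eq_mul, Pi.single_apply, Sigma.mk.injEq, true_and,
      heq_eq_eq]
    simp
  · intro l _ hl
    simp [Ne.symm hl]
  · simp

theorem matB_mulVec (f : (Σ k, V k) → ℝ) :
    matB H s β *ᵥ f = β • bridgeVec s (H.laplacian *ᵥ fun k => f ⟨k, s k⟩) := by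
  set c : Fin D → Fin D → ℝ := fun k l => H.weight k l * (f ⟨k, s k⟩ - f ⟨l, s l⟩) with hc
  set e : Fin D → (Σ k, V k) → ℝ := fun k => Pi.single ⟨k, s k⟩ 1 with he
  have hB : matB H s β *ᵥ f = ∑ k, ∑ l, if k < l then (β * c k l) • (e k - e l) else 0 := by
    simp only [matB, Matrix.sum_mulVec]
    refine Finset.sum_congr rfl fun k _ => Finset.sum_congr rfl fun l _ => ?_
    split_ifs
    · rw [Matrix.smul_mulVec, Matrix.vecMulVec_mulVec, edgeVec_dotProduct]
      simp only [MulOpposite.op_sub, hc, he, edgeVec]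
      ext a
      simp
      ring
    · rw [Matrix.zero_mulVec]
  -- Since `c` is antisymmetric, exchanging `k` and `l` in the terms with `e l` restores the sign,
  -- and every ordered pair then contributes to its first node.
  have hsplit : (∑ k, ∑ l, if k < l then (β * c k l) • (e k - e l) else 0) =
      (∑ k, ∑ l, if k < l then (β * c k l) • e k else 0) +
        ∑ k, ∑ l, if l < k then (β * c k l) • e k else 0 := by
    rw [Finset.sum_comm (f := fun k l => if l < k then (β * c k l) • e k else 0),
      ← Finset.sum_add_distrib]
    refine Finset.sum_congr rfl fun k _ => ?_
    rw [← Finset.sum_add_distrib]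
    refine Finset.sum_congr rfl fun l _ => ?_
    have : c l k = -c k l := by simp only [hc, H.symm l k]; ring
    split_ifs
    · rw [this]; module
    · simp
  rw [hB, hsplit, bridgeVec_eq_sum, Finset.smul_sum, ← Finset.sum_add_distrib]
  refine Finset.sum_congr rfl fun k _ => ?_
  rw [← Finset.sum_add_distrib, H.laplacian_mulVec_apply, Finset.sum_smul, Finset.smul_sum]
  refine Finset.sum_congr rfl fun l _ => ?_
  rw [smul_smul]
  rcases lt_trichotomy k l with h | h | h
  · simp [h, h.not_gt, hc, he]
  · subst h; simp
  · simp [h, h.not_gt, hc, he]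

theorem matB_mulVec_one : (matB H s β *ᵥ fun _ => (1 : ℝ)) = 0 := by
  rw [matB_mulVec, H.laplacian_mulVec_const]
  ext x
  simp [bridgeVec]

theorem msOp₁_selfAdjoint (X Y : Matrix (Σ k, V k) (Σ k, V k) ℝ) :
    frob X (msOp₁ G H s β Y) = frob (msOp₁ G H s β X) Y := by
  have hA := matAtilde_transpose G
  have hB := matB_transpose H s β
  simp only [msOp₁, frob_add_right, frob_sub_right, frob_neg_right, frob_add_left, frob_sub_left,
    frob_neg_left, frob_mul_mul hA hB, frob_mul_mul hB hA, frob_mul_mul hB hB]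

/-- `B` kills constants, so `P B P = B`. The coefficients of `B X B` are `p²` from the mean and `p
(1 - p)` from the variance; they add up to `p`, so no quadratic term remains. -/
theorem msOp_eq (p : ℝ) (X : Matrix (Σ k, V k) (Σ k, V k) ℝ) :
    msOp G H s β p X = msOp₀ G X + p • msOp₁ G H s β X := by
  have h : proj (Σ k, V k) * matAbar G H s β p * proj (Σ k, V k) =
      matAtilde G - p • matB H s β := by
    rw [matAbar, Matrix.mul_sub, Matrix.sub_mul, ← matAtilde, Matrix.mul_smul, Matrix.smul_mul,
      proj_mul (matB_transpose H s β) (matB_mulVec_one H s β), mul_proj (matB_mulVec_one H s β)]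
  rw [msOp, h, msOp₀, msOp₁]
  simp only [Matrix.sub_mul, Matrix.mul_sub, Matrix.smul_mul, Matrix.mul_smul]
  module

theorem msOp₀_vecMulVec (a b : (Σ k, V k) → ℝ) :
    msOp₀ G (vecMulVec a b) = vecMulVec (matAtilde G *ᵥ a) (matAtilde G *ᵥ b) :=
  mul_vecMulVec_mul (matAtilde_transpose G) a b

theorem msOp₁_vecMulVec {a b : (Σ k, V k) → ℝ} (ha : matAtilde G *ᵥ a = a)
    (hb : matAtilde G *ᵥ b = b) :
    msOp₁ G H s β (vecMulVec a b) = -vecMulVec (matB H s β *ᵥ a) b -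
      vecMulVec a (matB H s β *ᵥ b) + vecMulVec (matB H s β *ᵥ a) (matB H s β *ᵥ b) := by
  rw [msOp₁, mul_vecMulVec_mul (matAtilde_transpose G), mul_vecMulVec_mul (matB_transpose H s β),
    mul_vecMulVec_mul (matB_transpose H s β), ha, hb]

end Network

/-! ### Block vectors, bridge potentials and the bounds -/

section Bounds

variable {D : ℕ} {V : Fin D → Type*} [∀ k, Fintype (V k)]

theorem card_sigma_eq (hsize : ∀ k l, Fintype.card (V k) = Fintype.card (V l)) (k : Fin D) :
    (Fintype.card (Σ k, V k) : ℝ) = D * Fintype.card (V k) := by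
  rw [Fintype.card_sigma, Finset.sum_congr rfl fun l _ => hsize l k]
  simp

theorem card_mul_div_card (hne : ∀ k, Nonempty (V k))
    (hsize : ∀ k l, Fintype.card (V k) = Fintype.card (V l)) (k : Fin D) :
    (Fintype.card (V k) : ℝ) * (D / (Fintype.card (Σ k, V k) : ℝ)) = 1 := by
  have hD : (D : ℝ) ≠ 0 := Nat.cast_ne_zero.mpr (Nat.ne_of_gt k.pos)
  have := hne k
  have hc : (Fintype.card (V k) : ℝ) ≠ 0 := Nat.cast_ne_zero.mpr Fintype.card_ne_zero
  rw [card_sigma_eq hsize k]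
  field_simp

theorem card_sigma_pos (hne : ∀ k, Nonempty (V k)) (hD : 0 < D) :
    (0 : ℝ) < Fintype.card (Σ k, V k) := by
  have : Nonempty (Σ k, V k) := ⟨⟨⟨0, hD⟩, (hne _).some⟩⟩
  exact Nat.cast_pos.mpr Fintype.card_pos

theorem le_card_sigma (hne : ∀ k, Nonempty (V k)) : (D : ℝ) ≤ Fintype.card (Σ k, V k) := by
  rw [Fintype.card_sigma, Nat.cast_sum]
  calc (D : ℝ) = ∑ _k : Fin D, 1 := by simp
    _ ≤ _ := Finset.sum_le_sum fun k _ => by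
      have := hne k
      exact_mod_cast Fintype.card_pos (α := V k)

theorem wHat_eq_smul (u : Fin D → ℝ) :
    wHat V u = (√((Fintype.card (Σ k, V k) : ℝ) / D))⁻¹ • u := by
  ext k
  simp [wHat, div_eq_inv_mul]

theorem wHat_dotProduct (a b : Fin D → ℝ) :
    wHat V a ⬝ᵥ wHat V b = D / (Fintype.card (Σ k, V k) : ℝ) * (a ⬝ᵥ b) := by
  rw [wHat_eq_smul, wHat_eq_smul, smul_dotProduct, dotProduct_smul, smul_smul, ← mul_inv,
    Real.mul_self_sqrt (by positivity), inv_div, smul_eq_mul]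

theorem block_dotProduct (g : Fin D → ℝ) (x : (Σ k, V k) → ℝ) :
    (fun a => g a.1) ⬝ᵥ x = ∑ k, g k * ∑ v, x ⟨k, v⟩ := by
  simp only [dotProduct, Fintype.sum_sigma, Finset.mul_sum]

theorem wVec_dotProduct (hne : ∀ k, Nonempty (V k))
    (hsize : ∀ k l, Fintype.card (V k) = Fintype.card (V l)) (a b : Fin D → ℝ) :
    wVec V a ⬝ᵥ wVec V b = a ⬝ᵥ b := by
  have h1 : wVec V a ⬝ᵥ wVec V b =
      ∑ k, (Fintype.card (V k) : ℝ) * (wHat V a k * wHat V b k) := by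
    rw [show wVec V a = fun x => wHat V a x.1 from rfl, block_dotProduct]
    refine Finset.sum_congr rfl fun k _ => ?_
    simp [wVec]
    ring
  have h2 : ∀ k, wHat V a k * wHat V b k =
      D / (Fintype.card (Σ k, V k) : ℝ) * (a k * b k) := by
    intro k
    rw [wHat, wHat, div_mul_div_comm, Real.mul_self_sqrt (by positivity)]
    field_simp
  rw [h1, dotProduct]
  refine Finset.sum_congr rfl fun k _ => ?_
  rw [h2, ← mul_assoc, card_mul_div_card hne hsize, one_mul]

variable {H : WeightedGraph (Fin D)} {u : Fin D → Fin D → ℝ} {lam : Fin D → ℝ}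

theorem IsBackboneEigenbasis.sum_eq_zero (hu : IsBackboneEigenbasis H u lam) {i : Fin D}
    (hi : (i : ℕ) ≠ 0) : ∑ k, u i k = 0 := by
  have hD : 0 < D := i.pos
  have h := hu.orthonormal i ⟨0, hD⟩
  rw [hu.first ⟨0, hD⟩ rfl, if_neg (fun h => hi (by rw [h])), dotProduct, ← Finset.sum_mul] at h
  refine (mul_eq_zero.mp h).resolve_right ?_
  have : (0 : ℝ) < D := Nat.cast_pos.mpr hD
  positivity

theorem IsBackboneEigenbasis.laplacian_mulVec_wHat (hu : IsBackboneEigenbasis H u lam)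
    (i : Fin D) : H.laplacian *ᵥ wHat V (u i) = lam i • wHat V (u i) := by
  rw [wHat_eq_smul, Matrix.mulVec_smul, hu.eigen, smul_comm]

variable [∀ k, DecidableEq (V k)] (G : ∀ k, WeightedGraph (V k)) (s : ∀ k, V k)

theorem IsBackboneEigenbasis.matAtilde_mulVec_wVec (hu : IsBackboneEigenbasis H u lam)
    (hsize : ∀ k l, Fintype.card (V k) = Fintype.card (V l)) {i : Fin D} (hi : (i : ℕ) ≠ 0) :
    matAtilde G *ᵥ wVec V (u i) = wVec V (u i) := by
  have hs : ∑ x, wVec V (u i) x = 0 := by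
    rw [Fintype.sum_sigma]
    have : ∀ k, ∑ v : V k, wVec V (u i) ⟨k, v⟩ =
        (Fintype.card (V i) : ℝ) * (√((Fintype.card (Σ k, V k) : ℝ) / D))⁻¹ * u i k := by
      intro k
      rw [hsize i k]
      simp only [wVec, wHat, Finset.sum_const, Finset.card_univ, nsmul_eq_mul]
      ring
    rw [Finset.sum_congr rfl fun k _ => this k, ← Finset.mul_sum, hu.sum_eq_zero hi, mul_zero]
  rw [matAtilde_mulVec G hs, show wVec V (u i) = fun x => wHat V (u i) x.1 from rfl,
    lapSub_mulVec_block, sub_zero]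

theorem IsBackboneEigenbasis.matB_mulVec_wVec (hu : IsBackboneEigenbasis H u lam) (β : ℝ)
    (i : Fin D) :
    matB H s β *ᵥ wVec V (u i) = (β * lam i) • bridgeVec s (wHat V (u i)) := by
  rw [matB_mulVec]
  change β • bridgeVec s (H.laplacian *ᵥ wHat V (u i)) = _
  rw [hu.laplacian_mulVec_wHat]
  ext x
  simp only [bridgeVec, Pi.smul_apply, smul_eq_mul]
  split_ifs <;> ring

/-- The block mean free part of a vector supported on the bridge nodes. -/
noncomputable def bridgeFluct (g : Fin D → ℝ) : (Σ k, V k) → ℝ :=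
  bridgeVec s g - (D / (Fintype.card (Σ k, V k) : ℝ)) • fun x => g x.1

/-- The block mean free solution `y` of `L_sub y = z` for the vector `z = bridgeFluct s g`. -/
noncomputable def bridgePotential (g : Fin D → ℝ) : (Σ k, V k) → ℝ :=
  fun x => g x.1 * pinv (G x.1).laplacian x.2 (s x.1)

variable {G}

theorem sum_bridgePotential (g : Fin D → ℝ) (k : Fin D) :
    ∑ v, bridgePotential G s g ⟨k, v⟩ = 0 := by
  simp only [bridgePotential, ← Finset.mul_sum]
  rw [Finset.sum_congr rfl fun v _ => (G k).pinv_comm v (s k), (G k).sum_pinv, mul_zero]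

theorem block_dotProduct_bridgePotential (h g : Fin D → ℝ) :
    (fun x => h x.1) ⬝ᵥ bridgePotential G s g = 0 := by
  simp [block_dotProduct, sum_bridgePotential]

theorem block_dotProduct_bridgeFluct (hne : ∀ k, Nonempty (V k))
    (hsize : ∀ k l, Fintype.card (V k) = Fintype.card (V l)) (h g : Fin D → ℝ) :
    (fun x => h x.1) ⬝ᵥ bridgeFluct s g = 0 := by
  rw [block_dotProduct]
  refine Finset.sum_eq_zero fun k _ => ?_
  have := card_mul_div_card hne hsize k
  have e : ∑ v, bridgeFluct s g ⟨k, v⟩ =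
      g k * (1 - (Fintype.card (V k) : ℝ) * (D / (Fintype.card (Σ k, V k) : ℝ))) := by
    simp [bridgeFluct, bridgeVec, Finset.sum_sub_distrib, -Fintype.card_sigma]
    ring
  rw [e, this, sub_self, mul_zero, mul_zero]

/-- The potential is mean free, so `1 - Ã` acts on it as `L_sub`. On a block, `L_k L_k†` subtracts
the mean of the unit source at `s k`, and `1 / |V k| = D / N` by equal sizes. -/
theorem bridgePotential_sub_matAtilde_mulVec (hconn : ∀ k, (G k).toSimpleGraph.Connected)
    (hsize : ∀ k l, Fintype.card (V k) = Fintype.card (V l)) (g : Fin D → ℝ) :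
    bridgePotential G s g - matAtilde G *ᵥ bridgePotential G s g = bridgeFluct s g := by
  have hs : ∑ x, bridgePotential G s g x = 0 := by
    simp [Fintype.sum_sigma, sum_bridgePotential]
  rw [matAtilde_mulVec G hs, sub_sub_cancel]
  ext ⟨k, r⟩
  rw [lapSub_mulVec_apply]
  have e : (fun v => bridgePotential G s g ⟨k, v⟩) =
      g k • (pinv (G k).laplacian *ᵥ Pi.single (s k) 1) := by
    ext v; simp [bridgePotential]
  have hk : 1 / (Fintype.card (V k) : ℝ) = D / (Fintype.card (Σ k, V k) : ℝ) := by
    have h := card_mul_div_card (fun k => (hconn k).nonempty) hsize k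
    exact (eq_one_div_of_mul_eq_one_right h).symm
  rw [e, Matrix.mulVec_smul, Matrix.mulVec_mulVec, WeightedGraph.laplacian_mul_pinv (hconn k), hk]
  simp [bridgeFluct, bridgeVec, Matrix.one_apply, -Fintype.card_sigma]
  split_ifs <;> ring

/-- The potential is orthogonal to block constants, so only its values `g k * L_k†(s_k, s_k)` at the
bridge nodes enter. -/
theorem bridgePotential_dotProduct_bridgeFluct (g : Fin D → ℝ) :
    bridgePotential G s g ⬝ᵥ bridgeFluct s g = g ⬝ᵥ (matI G s *ᵥ g) := by
  rw [bridgeFluct, dotProduct_sub, dotProduct_smul,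
    dotProduct_comm _ (fun x : Σ k, V k => g x.1), block_dotProduct_bridgePotential, smul_zero, sub_zero, dotProduct_comm, bridgeVec_dotProduct]
  simp only [bridgePotential, matI, dotProduct, Matrix.mulVec_diagonal]
  exact Finset.sum_congr rfl fun k _ => by ring

theorem bridgeFluct_dotProduct_self (hne : ∀ k, Nonempty (V k))
    (hsize : ∀ k l, Fintype.card (V k) = Fintype.card (V l)) (g : Fin D → ℝ) :
    bridgeFluct s g ⬝ᵥ bridgeFluct s g =
      (1 - D / (Fintype.card (Σ k, V k) : ℝ)) * (g ⬝ᵥ g) := by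
  conv_lhs => lhs; rw [bridgeFluct]
  rw [sub_dotProduct, smul_dotProduct, block_dotProduct_bridgeFluct s hne hsize, smul_zero,
    sub_zero, bridgeVec_dotProduct]
  simp only [bridgeFluct, bridgeVec, dotProduct, Pi.sub_apply, Pi.smul_apply, if_true, smul_eq_mul,
    Finset.mul_sum]
  exact Finset.sum_congr rfl fun k _ => by ring

/-- The second-order coefficient is the lower bound plus a term that is nonnegative, and at most the
gap to the upper bound if the Laplacian eigenvalues do not exceed `1`. -/
theorem exists_secondOrderCoeff_eq (hconn : ∀ k, (G k).toSimpleGraph.Connected)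
    (hstrength : ∀ k r, ∑ v, (G k).weight r v < 1)
    (hsize : ∀ k l, Fintype.card (V k) = Fintype.card (V l))
    (hu : IsBackboneEigenbasis H u lam) (β : ℝ) {i j : Fin D} (hi : (i : ℕ) ≠ 0)
    (hj : (j : ℕ) ≠ 0)
    {E : (Σ k, V k) × (Σ k, V k) → Matrix (Σ k, V k) (Σ k, V k) ℝ}
    {μ : (Σ k, V k) × (Σ k, V k) → ℝ} (hE : IsOrthonormalEigenbasis (msOp₀ G) E μ) :
    ∃ t : ℝ, secondOrderCoeff (msOp₁ G H s β) E μ (vecMulVec (wVec V (u i)) (wVec V (u j))) 1 =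
        lowerBound G s β u lam i j + β ^ 4 * lam i ^ 2 * lam j ^ 2 * t ∧ 0 ≤ t ∧
      ((∀ k x, Module.End.HasEigenvalue (Matrix.toLin' (G k).laplacian) x → x ≤ 1) →
        t ≤ (wHat V (u i) ⬝ᵥ (matI G s *ᵥ wHat V (u i))) *
          ((D : ℝ) * ((Fintype.card (Σ k, V k) : ℝ) - D) /
            (Fintype.card (Σ k, V k) : ℝ) ^ 2)) := by
  have hne : ∀ k, Nonempty (V k) := fun k => (hconn k).nonempty
  have hA : (matAtilde G).IsHermitian := by
    rw [Matrix.IsHermitian, conjTranspose_eq_transpose_of_trivial, matAtilde_transpose]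
  obtain ⟨Q, hQ, hQ0, hQ1⟩ := exists_stein hA (matAtilde_eigenvalue_bounds hstrength)
    (bridgePotential G s (wHat V (u i))) (bridgePotential G s (wHat V (u j)))
  simp only [bridgePotential_sub_matAtilde_mulVec s hconn hsize] at hQ hQ0 hQ1
  have hAi := hu.matAtilde_mulVec_wVec G hsize hi
  have hAj := hu.matAtilde_mulVec_wVec G hsize hj
  have hyi := bridgePotential_sub_matAtilde_mulVec s hconn hsize (wHat V (u i))
  have hyj := bridgePotential_sub_matAtilde_mulVec s hconn hsize (wHat V (u j))
  -- Splits `B w_i` into its block means, again a multiple of `w_i`, and the fluctuation `z_i`.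
  have hBi : matB H s β *ᵥ wVec V (u i) = (β * lam i) •
      ((D / (Fintype.card (Σ k, V k) : ℝ)) • wVec V (u i) + bridgeFluct s (wHat V (u i))) := by
    rw [hu.matB_mulVec_wVec, bridgeFluct, ← show wVec V (u i) = fun x => wHat V (u i) x.1 from rfl,
      add_sub_cancel]
  have hBj : matB H s β *ᵥ wVec V (u j) = (β * lam j) •
      ((D / (Fintype.card (Σ k, V k) : ℝ)) • wVec V (u j) + bridgeFluct s (wHat V (u j))) := by
    rw [hu.matB_mulVec_wVec, bridgeFluct, ← show wVec V (u j) = fun x => wHat V (u j) x.1 from rfl,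
      add_sub_cancel]
  have hwy : ∀ a g, wVec V (u a) ⬝ᵥ bridgePotential G s g = 0 := fun a g =>
    block_dotProduct_bridgePotential s _ g
  have hwz : ∀ a g, wVec V (u a) ⬝ᵥ bridgeFluct s g = 0 := fun a g =>
    block_dotProduct_bridgeFluct s hne hsize _ g
  have hww : ∀ a, wVec V (u a) ⬝ᵥ wVec V (u a) = 1 := fun a => by
    rw [wVec_dotProduct hne hsize, hu.orthonormal, if_pos rfl]
  have hyz := fun g => bridgePotential_dotProduct_bridgeFluct (G := G) s g
  set wi := wVec V (u i)
  set wj := wVec V (u j)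
  set zi := bridgeFluct s (wHat V (u i))
  set zj := bridgeFluct s (wHat V (u j))
  set yi := bridgePotential G s (wHat V (u i))
  set yj := bridgePotential G s (wHat V (u j))
  set κ : ℝ := D / (Fintype.card (Σ k, V k) : ℝ) with hκ
  set p : ℝ := β * lam i with hp
  set q : ℝ := β * lam j with hq
  have h₀ := msOp₀_selfAdjoint G
  have hX : msOp₀ G (vecMulVec wi wj) = vecMulVec wi wj := by rw [msOp₀_vecMulVec, hAi, hAj]
  -- Because `Ã` fixes `w_i` and `w_j`, `1 - 𝒜₀` maps `y_i w_jᵀ` to `z_i w_jᵀ` and `w_i y_jᵀ` to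
  -- `w_i z_jᵀ`. The coefficients are those of the expanded `𝒜₁(W_ij)`.
  set R : Matrix (Σ k, V k) (Σ k, V k) ℝ := (p * q * κ - p) • vecMulVec yi wj +
    (p * q * κ - q) • vecMulVec wi yj + (p * q) • Q with hR
  have hRR : R - msOp₀ G R = (p * q * κ - p) • vecMulVec zi wj +
      (p * q * κ - q) • vecMulVec wi zj + (p * q) • vecMulVec zi zj := by
    have e1 : msOp₀ G R = (p * q * κ - p) • msOp₀ G (vecMulVec yi wj) +
        (p * q * κ - q) • msOp₀ G (vecMulVec wi yj) + (p * q) • msOp₀ G Q := by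
      simp only [hR, msOp₀, Matrix.mul_add, Matrix.add_mul, Matrix.mul_smul, Matrix.smul_mul]
    rw [e1, msOp₀_vecMulVec, msOp₀_vecMulVec, hAi, hAj, ← hQ, ← hyi, ← hyj, sub_vecMulVec,
      vecMulVec_sub, msOp₀, hR]
    module
  have hF : msOp₁ G H s β (vecMulVec wi wj) =
      (p * q * κ ^ 2 - p * κ - q * κ) • vecMulVec wi wj + (R - msOp₀ G R) := by
    rw [msOp₁_vecMulVec G H s β hAi hAj, hBi, hBj, hRR]
    ext a b
    simp [vecMulVec_apply]
    ring
  have hc := secondOrderCoeff_eq hE h₀ (msOp₁_selfAdjoint G H s β) hX hF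
  -- Moving `1 - 𝒜₀` onto `Q` yields `⟨z_i z_jᵀ, a bᵀ⟩ = (z_i · a)(z_j · b)`. This removes the cross
  -- terms of `Q`, although `Q` is not explicit.
  have hQz : ∀ a b : (Σ k, V k) → ℝ, zi ⬝ᵥ a = 0 ∨ zj ⬝ᵥ b = 0 →
      frob Q (vecMulVec a b - msOp₀ G (vecMulVec a b)) = 0 := by
    intro a b hab
    rw [frob_sub_right, h₀, ← frob_sub_left, msOp₀, hQ, frob_vecMulVec, mul_eq_zero]
    exact hab
  have hQ2 : frob Q (vecMulVec zi wj) = 0 := by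
    rw [← hyi, sub_vecMulVec]
    have := hQz yi wj (Or.inr (by rw [dotProduct_comm]; exact hwz _ _))
    rwa [msOp₀_vecMulVec, hAj] at this
  have hQ3 : frob Q (vecMulVec wi zj) = 0 := by
    rw [← hyj, vecMulVec_sub]
    have := hQz wi yj (Or.inl (by rw [dotProduct_comm]; exact hwz _ _))
    rwa [msOp₀_vecMulVec, hAi] at this
  refine ⟨frob Q (vecMulVec zi zj), ?_, hQ0, fun hL => ?_⟩
  · rw [hc, hRR, hR]
    have z1 : wi ⬝ᵥ zi = 0 := hwz _ _
    have z2 : wj ⬝ᵥ zj = 0 := hwz _ _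
    have z3 : yi ⬝ᵥ wi = 0 := by rw [dotProduct_comm]; exact hwy _ _
    have n1 : wi ⬝ᵥ wi = 1 := hww i
    have n2 : wj ⬝ᵥ wj = 1 := hww j
    simp only [frob_add_left, frob_add_right, frob_smul_left, frob_smul_right, frob_vecMulVec, hQ2,
      hQ3, z1, z2, z3, n1, n2]
    rw [show yi ⬝ᵥ zi = _ from hyz _, show yj ⬝ᵥ zj = _ from hyz _, lowerBound, ← hκ, hp, hq]
    ring
  · refine (hQ1 (matAtilde_eigenvalue_nonneg hL)).trans (le_of_eq ?_)
    rw [show yi ⬝ᵥ zi = _ from hyz _, bridgeFluct_dotProduct_self s hne hsize, wHat_dotProduct,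
      hu.orthonormal, if_pos rfl]
    have hN := (card_sigma_pos hne i.pos).ne'
    field_simp

/-- The form is a sum of the diagonal entries weighted by squares. The other factors of the bounds
do not involve the bridge nodes. -/
theorem matI_form_mono {G : ∀ k, WeightedGraph (V k)} {s t : ∀ k, V k}
    (h : ∀ k, pinv (G k).laplacian (t k) (t k) ≤ pinv (G k).laplacian (s k) (s k))
    (g : Fin D → ℝ) : g ⬝ᵥ (matI G t *ᵥ g) ≤ g ⬝ᵥ (matI G s *ᵥ g) := by
  simp only [matI, dotProduct, Matrix.mulVec_diagonal]
  refine Finset.sum_le_sum fun k _ => ?_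
  nlinarith [mul_le_mul_of_nonneg_left (h k) (mul_self_nonneg (g k))]

theorem lowerBound_mono {G : ∀ k, WeightedGraph (V k)} {s t : ∀ k, V k}
    (h : ∀ k, pinv (G k).laplacian (t k) (t k) ≤ pinv (G k).laplacian (s k) (s k)) (β : ℝ)
    (i j : Fin D) : lowerBound G t β u lam i j ≤ lowerBound G s β u lam i j :=
  add_le_add (mul_le_mul_of_nonneg_left (matI_form_mono h _) (by positivity))
    (mul_le_mul_of_nonneg_left (matI_form_mono h _) (by positivity))

theorem upperBound_mono {G : ∀ k, WeightedGraph (V k)} {s t : ∀ k, V k}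
    (h : ∀ k, pinv (G k).laplacian (t k) (t k) ≤ pinv (G k).laplacian (s k) (s k)) (β : ℝ)
    (i j : Fin D) : upperBound G t β u lam i j ≤ upperBound G s β u lam i j := by
  refine add_le_add (lowerBound_mono h β i j)
    (mul_le_mul_of_nonneg_left (matI_form_mono h _) ?_)
  -- The gap between the bounds is monotone only because its factor `N - D` is nonnegative: every
  -- block contains at least its bridge node.
  have := le_card_sigma (V := V) fun k => ⟨s k⟩
  have : (0 : ℝ) ≤ Fintype.card (Σ k, V k) - D := by linarith
  positivity

/-- `w_c · B w_d` reads only bridge values and is a multiple of `ŵ_c · ŵ_d`. Thus `B` is diagonal on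
the `w`'s, and each term of `𝒜₁` has a vanishing factor in the index that differs. -/
theorem IsBackboneEigenbasis.frob_msOp₁_eq_zero (hne : ∀ k, Nonempty (V k))
    (hsize : ∀ k l, Fintype.card (V k) = Fintype.card (V l))
    (hu : IsBackboneEigenbasis H u lam) (β : ℝ) {i j a b : Fin D}
    (ha : (a : ℕ) ≠ 0) (hb : (b : ℕ) ≠ 0) (hab : (i, j) ≠ (a, b)) :
    frob (vecMulVec (wVec V (u i)) (wVec V (u j)))
      (msOp₁ G H s β (vecMulVec (wVec V (u a)) (wVec V (u b)))) = 0 := by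
  have hw : ∀ c d, wVec V (u c) ⬝ᵥ wVec V (u d) = if c = d then 1 else 0 := fun c d => by
    rw [wVec_dotProduct hne hsize, hu.orthonormal]
  have hB : ∀ c d, c ≠ d → wVec V (u c) ⬝ᵥ (matB H s β *ᵥ wVec V (u d)) = 0 := by
    intro c d hcd
    rw [hu.matB_mulVec_wVec, dotProduct_smul, dotProduct_comm, bridgeVec_dotProduct]
    change _ • (wHat V (u d) ⬝ᵥ wHat V (u c)) = 0
    rw [wHat_dotProduct, hu.orthonormal, if_neg hcd.symm, mul_zero, smul_zero]
  rw [msOp₁_vecMulVec G H s β (hu.matAtilde_mulVec_wVec G hsize ha)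
    (hu.matAtilde_mulVec_wVec G hsize hb)]
  simp only [frob_add_right, frob_sub_right, frob_neg_right, frob_vecMulVec, hw]
  by_cases h : i = a
  · have hj : j ≠ b := fun h' => hab (by rw [h, h'])
    simp [hB j b hj, hj]
  · simp [hB i a h, h]

end Bounds

end NoN

/-! ### The main theorem -/

open NoN in
theorem mainTheorem12 {D : ℕ} {V : Fin D → Type*} [∀ k, Fintype (V k)] [∀ k, DecidableEq (V k)]
    (G : ∀ k, WeightedGraph (V k)) (H : WeightedGraph (Fin D)) (β : ℝ)
    (hconn : ∀ k, (G k).toSimpleGraph.Connected)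
    (hstrength : ∀ k r, ∑ v, (G k).weight r v < 1)
    (hsize : ∀ k l, Fintype.card (V k) = Fintype.card (V l))
    (u : Fin D → Fin D → ℝ) (lam : Fin D → ℝ) (hu : IsBackboneEigenbasis H u lam) :
    -- the mean square operator is an affine perturbation
    (∀ (s : ∀ k, V k) (p : ℝ) (X : Matrix (Σ k, V k) (Σ k, V k) ℝ),
      msOp G H s β p X = msOp₀ G X + p • msOp₁ G H s β X) ∧
    -- the matrices `W_ij` are orthonormal eigenmatrices for the eigenvalue `1`,
    -- and the first-order perturbation is diagonal on them
    (∀ (s : ∀ k, V k) (i j a b : Fin D), (i : ℕ) ≠ 0 → (j : ℕ) ≠ 0 → (a : ℕ) ≠ 0 → (b : ℕ) ≠ 0 →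
      msOp₀ G (vecMulVec (wVec V (u i)) (wVec V (u j))) =
        vecMulVec (wVec V (u i)) (wVec V (u j)) ∧
      frob (vecMulVec (wVec V (u i)) (wVec V (u j))) (vecMulVec (wVec V (u a)) (wVec V (u b))) =
        (if (i, j) = (a, b) then 1 else 0) ∧
      ((i, j) ≠ (a, b) → frob (vecMulVec (wVec V (u i)) (wVec V (u j)))
        (msOp₁ G H s β (vecMulVec (wVec V (u a)) (wVec V (u b)))) = 0)) ∧
    -- the second-order coefficient and its bounds
    (∀ (s : ∀ k, V k) (i j : Fin D), (i : ℕ) ≠ 0 → (j : ℕ) ≠ 0 →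
      ∀ (E : (Σ k, V k) × (Σ k, V k) → Matrix (Σ k, V k) (Σ k, V k) ℝ)
        (μ : (Σ k, V k) × (Σ k, V k) → ℝ), IsOrthonormalEigenbasis (msOp₀ G) E μ →
        lowerBound G s β u lam i j ≤
            secondOrderCoeff (msOp₁ G H s β) E μ (vecMulVec (wVec V (u i)) (wVec V (u j))) 1 ∧
        ((∀ k x, Module.End.HasEigenvalue (Matrix.toLin' (G k).laplacian) x → x ≤ 1) →
          secondOrderCoeff (msOp₁ G H s β) E μ (vecMulVec (wVec V (u i)) (wVec V (u j))) 1 ≤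
            upperBound G s β u lam i j) ∧
        -- it is the second Taylor coefficient along every branch of eigenvalues from `W_ij`
        (∀ (γ : ℝ → ℝ) (Y : ℝ → Matrix (Σ k, V k) (Σ k, V k) ℝ),
          ContDiffAt ℝ 2 γ 0 → (∀ x y, ContDiffAt ℝ 2 (fun p => Y p x y) 0) →
          Y 0 = vecMulVec (wVec V (u i)) (wVec V (u j)) →
          (∀ᶠ p in 𝓝 0, msOp G H s β p (Y p) = γ p • Y p) →
          iteratedDeriv 2 γ 0 / 2 =
            secondOrderCoeff (msOp₁ G H s β) E μ
              (vecMulVec (wVec V (u i)) (wVec V (u j))) 1)) ∧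
    -- nodes of maximum information centrality minimize the diagonal entries of `L_k†`
    (∀ (k : Fin D) (t : V k), (G k).IsMostCentral t →
      ∀ v, pinv (G k).laplacian t t ≤ pinv (G k).laplacian v v) ∧
    -- hence they minimize both bounds over all choices of the bridge nodes
    (∀ t : ∀ k, V k, (∀ k, (G k).IsMostCentral (t k)) →
      ∀ (s : ∀ k, V k) (i j : Fin D), (i : ℕ) ≠ 0 → (j : ℕ) ≠ 0 →
        lowerBound G t β u lam i j ≤ lowerBound G s β u lam i j ∧
        upperBound G t β u lam i j ≤ upperBound G s β u lam i j) := by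
  have hne : ∀ k, Nonempty (V k) := fun k => (hconn k).nonempty
  refine ⟨fun s p X => msOp_eq G H s β p X, fun s i j a b hi hj ha hb => ⟨?_, ?_, fun hab => ?_⟩,
    fun s i j hi hj E μ hE => ?_, fun k t ht v => ht.pinv_le (hconn k) v,
    fun t ht s i j _ _ => ?_⟩
  · rw [msOp₀_vecMulVec, hu.matAtilde_mulVec_wVec G hsize hi, hu.matAtilde_mulVec_wVec G hsize hj]
  · rw [frob_vecMulVec, wVec_dotProduct hne hsize, wVec_dotProduct hne hsize, hu.orthonormal,
      hu.orthonormal, ite_zero_mul_ite_zero, mul_one]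
    simp only [Prod.mk.injEq]
  · exact hu.frob_msOp₁_eq_zero s hne hsize β ha hb hab
  · obtain ⟨t, h1, h2, h3⟩ := exists_secondOrderCoeff_eq s hconn hstrength hsize hu β hi hj hE
    refine ⟨?_, fun hL => ?_, fun γ Y hγ hY hY0 h => ?_⟩
    · rw [h1]
      have : 0 ≤ β ^ 4 * lam i ^ 2 * lam j ^ 2 * t := by positivity
      linarith
    · rw [h1, upperBound]
      have := mul_le_mul_of_nonneg_left (h3 hL)
        (show 0 ≤ β ^ 4 * lam i ^ 2 * lam j ^ 2 by positivity)
      linarith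
    · refine iteratedDeriv_two_eigenvalue hE (msOp₀_selfAdjoint G) (msOp₁_selfAdjoint G H s β) ?_ ?_
        hγ hY hY0 ?_
      · rw [msOp₀_vecMulVec, hu.matAtilde_mulVec_wVec G hsize hi,
          hu.matAtilde_mulVec_wVec G hsize hj]
      · rw [frob_vecMulVec, wVec_dotProduct hne hsize, wVec_dotProduct hne hsize, hu.orthonormal,
          hu.orthonormal, if_pos rfl, if_pos rfl, mul_one]
      · simpa only [msOp_eq] using h
  · have h := fun k => (ht k).pinv_le (hconn k) (s k)
    exact ⟨lowerBound_mono h β i j, upperBound_mono h β i j⟩
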